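/- Let $K$ be an algebraically closed field of characteristic $0$. For a subset $X\subseteq\mathbb P^N$ and $s\ge 1$, let $X^s$ (the $s$-th secant variety) be the Zariski closure of the union of all linear spaces spanned by $s$ points of $X$; if $\dim X=n$, its expected dimension is $\min\{N,\,sn+s-1\}$, and its defectiveness is $\min\{N,\,sn+s-1\}-\dim X^s$. We say that $X^s$ is $\delta$-defective if its defectiveness is $\delta>0$. Let $X=\nu_4(G_{4,8})\subset\mathbb P(\bigwedge^4K^8)=\mathbb P^{69}$ be the Grassmannian of $4$-dimensional subspaces of $K^8$ in its Plücker embedding, that is, the set of all points $[v_1\wedge v_2\wedge v_3\wedge v_4]$ with $v_1,\dots,v_4\in K^8$ linearly independent. Then $\dim X=16$, so that the expected dimension of $X^3$ is $\min\{69,\,3\cdot 16+2\}=50$, but $$\dim X^3=49 .$$ Hence $X^3$ is $1$-defective. Moreover, if $H_1,H_2,H_3\subset K^8$ are $4$-dimensional subspaces with $H_i\cap H_j=0$ for $i\ne j$ (in particular, if they are generic), and $I_j$ is the ideal of the exterior algebra $\bigwedge(K^8)$ generated by $H_j$, then the degree-$4$ part $W=[I_1^2\cap I_2^2\cap I_3^2]_4$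 has dimension $20$. -/

import Mathlib

open Module

/-- The zero locus in `ℙ(E)` of a set of polynomials in the linear forms on `E`
(only used for sets of homogeneous polynomials, for which the choice of the
representative `p.rep` is immaterial). -/
def projZeroLocus (K E : Type*) [Field K] [AddCommGroup E] [Module K E]
    (S : Set (MvPolynomial (Dual K E) K)) : Set (Projectivization K E) :=
  {p | ∀ f ∈ S, MvPolynomial.eval (fun φ : Dual K E => φ p.rep) f = 0}

/-- The Zariski topology on the projective space `ℙ(E)`: the closed sets are the common zero
loci of sets of homogeneous polynomials. -/
abbrev zariskiTopology (K E : Type*) [Field K] [AddCommGroup E] [Module K E] :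
    TopologicalSpace (Projectivization K E) :=
  TopologicalSpace.ofClosed
    {Z | ∃ S : Set (MvPolynomial (Dual K E) K),
      (∀ f ∈ S, ∃ d : ℕ, f.IsHomogeneous d) ∧ Z = projZeroLocus K E S}
    (by
      refine ⟨{1}, ?_, ?_⟩
      · rintro f rfl
        exact ⟨0, MvPolynomial.isHomogeneous_one _ _⟩
      · ext p
        simp [projZeroLocus])
    (by
      intro A hA
      refine ⟨{f | (∃ d : ℕ, f.IsHomogeneous d) ∧ ∃ Z ∈ A, ∀ p ∈ Z,
        MvPolynomial.eval (fun φ : Dual K E => φ p.rep) f = 0}, fun f hf => hf.1, ?_⟩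
      ext p
      constructor
      · rintro hp f ⟨-, Z, hZ, hf⟩
        exact hf p (hp Z hZ)
      · intro hp Z hZ
        obtain ⟨S, hS, rfl⟩ := hA hZ
        exact fun f hf => hp f ⟨hS f hf, _, hZ, fun q hq => hq f hf⟩)
    (by
      rintro _ ⟨S, hS, rfl⟩ _ ⟨T, hT, rfl⟩
      refine ⟨{h | ∃ f ∈ S, ∃ g ∈ T, h = f * g}, ?_, ?_⟩
      · rintro _ ⟨f, hf, g, hg, rfl⟩
        obtain ⟨d, hd⟩ := hS f hf
        obtain ⟨e, he⟩ := hT g hg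
        exact ⟨d + e, hd.mul he⟩
      · ext p
        constructor
        · rintro (hp | hp) _ ⟨f, hf, g, hg, rfl⟩
          · rw [map_mul, hp f hf, zero_mul]
          · rw [map_mul, hp g hg, mul_zero]
        · intro hp
          by_contra hcon
          rw [Set.mem_union, not_or] at hcon
          obtain ⟨h1, h2⟩ := hcon
          simp only [projZeroLocus, Set.mem_ofPred_eq, not_forall] at h1 h2
          obtain ⟨f, hf, hf0⟩ := h1
          obtain ⟨g, hg, hg0⟩ := h2
          have h := hp (f * g) ⟨f, hf, g, hg, rfl⟩
          rw [map_mul] at h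
          exact (mul_ne_zero hf0 hg0) h)

/-- The dimension of a subset of projective space: its Krull dimension in the topology
induced by the Zariski topology. -/
noncomputable def zariskiDim (K : Type*) {E : Type*} [Field K] [AddCommGroup E] [Module K E]
    (Z : Set (Projectivization K E)) : WithBot ℕ∞ :=
  letI : TopologicalSpace (Projectivization K E) := zariskiTopology K E
  topologicalKrullDim Z

/-- The `s`-th secant variety of `X ⊆ ℙ(E)`: the Zariski closure of the union of all
linear spaces spanned by `s` points of `X`. -/
def secantVariety (K : Type*) {E : Type*} [Field K] [AddCommGroup E] [Module K E]
    (X : Set (Projectivization K E)) (s : ℕ) : Set (Projectivization K E) :=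
  letI : TopologicalSpace (Projectivization K E) := zariskiTopology K E
  closure {p | ∃ x : Fin s → Projectivization K E,
    (∀ i, x i ∈ X) ∧ p.submodule ≤ ⨆ i, (x i).submodule}

/-- The expected dimension `min {N, s n + s - 1}` of the `s`-th secant variety of an
`n`-dimensional variety in `ℙ^N`. -/
def expectedSecantDim (N n s : ℕ) : ℤ := min (N : ℤ) (s * n + s - 1)

/-- The `s`-th secant variety of `X ⊆ ℙ(E) = ℙ^N` has defectiveness `δ`, that is,
`δ = min {N, s n + s - 1} - dim X^s` with `n = dim X`; it is `δ`-defective if `δ > 0`. -/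
def HasSecantDefect (K : Type*) {E : Type*} [Field K] [AddCommGroup E] [Module K E]
    (X : Set (Projectivization K E)) (s : ℕ) (δ : ℤ) : Prop :=
  ∃ N n d : ℕ, finrank K E = N + 1 ∧ zariskiDim K X = n ∧
    zariskiDim K (secantVariety K X s) = d ∧ δ = expectedSecantDim N n s - d

/-- The image in `ℙ(⋀^k V)` of the Grassmannian of `k`-dimensional subspaces of `V` under the
Plücker embedding `⟨v₁, …, v_k⟩ ↦ [v₁ ∧ ⋯ ∧ v_k]`. -/
def pluckerGrassmannian (K : Type*) [Field K] (k : ℕ) (V : Type*) [AddCommGroup V] [Module K V] :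
    Set (Projectivization K (⋀[K]^k V)) :=
  {p | ∃ v : Fin k → V, LinearIndependent K v ∧
    p.submodule = Submodule.span K {exteriorPower.ιMulti K k v}}

/-- The ideal of the exterior algebra of `V` generated by the vectors of the subspace `H`.
It is defined as a left ideal, but since it is generated by elements of degree `1` it is
two-sided. -/
def exteriorIdeal (K : Type*) {V : Type*} [Field K] [AddCommGroup V] [Module K V]
    (H : Submodule K V) : Ideal (ExteriorAlgebra K V) :=
  Ideal.span (ExteriorAlgebra.ι K '' (H : Set V))

/-- The degree `d` part of the intersection of the squares of the ideals generated by the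
subspaces `H i` in the exterior algebra of `V`. -/
def fatIntersection (K : Type*) {V ι : Type*} [Field K] [AddCommGroup V] [Module K V]
    (H : ι → Submodule K V) (d : ℕ) : Submodule K (ExteriorAlgebra K V) :=
  (⨅ i, (exteriorIdeal K (H i) * exteriorIdeal K (H i)).restrictScalars K) ⊓ ⋀[K]^d V

/-!
The dimensions of the Grassmannian and of its third secant variety are ranks of differentials. They
are the image of a homogeneous polynomial map and the closure of the image of another one: by `pluckerGrassmannian_eq_projImage` and
`secant_pluckerGrassmannian_eq_projImage`, the union of the spaces spanned by `s` points of the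
Grassmannian is the set of classes of sums of `s` wedge products of four vectors. The image of such
a map `Φ`, and its closure, have dimension one less than the generic rank of the differential of
`Φ`.

* Upper bound (`zariskiDim_le_of_subset_closure_projImage`): a chain of irreducible closed subsets
  of length `r` gives `r + 1` functions on the cone over the closure of the image which are
  algebraically independent, since the ideals along the chain are prime; by the Jacobian criterion
  the differentials of the functions are independent at a general parameter, and they factor through
  the differential of `Φ`.
* Lower bound (`le_zariskiDim_of_projImage_subset`): the images of linear families of parameters of
  increasing dimension through a parameter of the given rank form a strictly increasing chain of
  irreducible sets. Each of them is separated from the next one by a polynomial, again by the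
  Jacobian criterion.

The span of the partial derivatives of a sum of wedge products is the sum of the tangent spaces to
the cone over the Grassmannian at the summands (`span_range_partialDeriv_sumWedge`); this is
Terracini's lemma. The tangent space at `⋀⁴ H` is spanned by the products with three factors in `H`
and has dimension `17` (`finrank_grassmannTangent`). So the Grassmannian has dimension `16`, and the
third secant variety would have dimension `3 · 17 - 1 = 50` if three tangent spaces were
independent.

The tangent spaces at three pairwise complementary subspaces span a space of dimension `50` only
(`finrank_iSup_grassmannTangent`), whence the dimension `49`. In a suitable basis `e_i`, `f_i` of
`K⁸` the subspaces are `⟨e⟩`, `⟨f⟩` and `⟨e + f⟩`. Their Plücker points lie on the rational normal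
quartic `q (x, y) = ⋀ (x e_i + y f_i)`, and the element `2 q - ∂q/∂y` at `(1, 1)` of the third
tangent space has no terms of bidegree `(2, 2)` in `e`, `f`, hence lies in the sum of the two other
ones: the dimension is at most `50`. Conversely, a functional which vanishes on the three tangent spaces is
given by its values at `e_i ∧ e_j ∧ f_k ∧ f_l`, and vanishing at `⟨e + f⟩` means that these satisfy
the Bianchi identity. So the functionals are algebraic curvature tensors in dimension four, which
form a space of dimension `20`, and `70 - 20 = 50`.

Finally, in degree four the square of the ideal generated by `H` is the orthogonal of the tangent
space at the annihilator of `H` (`mem_exteriorIdeal_sq_iff`): contraction with a linear form which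
vanishes on `H` preserves the ideal and its square. The annihilators of three pairwise complementary
subspaces are pairwise complementary, so the intersection of the squares has dimension
`70 - 50 = 20`.
-/

/-! ### Jacobians and algebraic independence -/

/-- The chain rule for a derivation and a polynomial expression. -/
theorem Derivation.map_mvAeval {K A M ι : Type*} [CommRing K] [CommRing A] [Algebra K A]
    [AddCommGroup M] [Module K M] [Module A M] [IsScalarTower K A M] [Fintype ι]
    (D : Derivation K A M) (f : ι → A) (P : MvPolynomial ι K) :
    D (MvPolynomial.aeval f P) =
      ∑ i, MvPolynomial.aeval f (MvPolynomial.pderiv i P) • D (f i) := by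
  classical
  induction P using MvPolynomial.induction_on with
  | C a => simp
  | add p q hp hq => simp [hp, hq, add_smul, Finset.sum_add_distrib]
  | mul_X p j hp =>
    rw [map_mul, Derivation.leibniz, hp, MvPolynomial.aeval_X, Finset.smul_sum]
    simp only [Derivation.leibniz, MvPolynomial.pderiv_X, map_add, smul_eq_mul, map_mul,
      MvPolynomial.aeval_X, add_smul, Finset.sum_add_distrib, mul_smul]
    congr 1
    rw [Finset.sum_eq_single j]
    · simp
    · intro b _ hb
      simp [hb]
    · simp

theorem MvPolynomial.exists_eval_ne_zero {K σ : Type*} [Field K] [Infinite K]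
    {p : MvPolynomial σ K} (hp : p ≠ 0) : ∃ t, MvPolynomial.eval t p ≠ 0 := by
  by_contra! h
  exact hp (MvPolynomial.funext fun t => by simpa using h t)

/-- One direction of the Jacobian criterion: polynomials whose Jacobian determinant does not
vanish identically are algebraically independent. -/
theorem algebraicIndependent_of_det_jacobian_ne_zero {K ι : Type*} [Field K] [CharZero K]
    [Fintype ι] [DecidableEq ι] (f : ι → MvPolynomial ι K)
    (h : (Matrix.of fun i k => MvPolynomial.pderiv k (f i)).det ≠ 0) :
    AlgebraicIndependent K f := by
  rw [algebraicIndependent_iff]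
  by_contra! hcon
  obtain ⟨Q, hQ, hQ0⟩ := hcon
  -- a nontrivial relation of least degree; its partial derivatives are again relations
  obtain ⟨P, ⟨hP, hP0⟩, hmin⟩ := (measure (MvPolynomial.totalDegree (R := K) (σ := ι))).wf.has_min
    {P | MvPolynomial.aeval f P = 0 ∧ P ≠ 0} ⟨Q, hQ, hQ0⟩
  have hrel : ∀ i, MvPolynomial.aeval f (MvPolynomial.pderiv i P) = 0 := by
    have h0 : Matrix.vecMul (fun i => MvPolynomial.aeval f (MvPolynomial.pderiv i P))
        (Matrix.of fun i k => MvPolynomial.pderiv k (f i)) = 0 := by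
      ext1 k
      have := Derivation.map_mvAeval (MvPolynomial.pderiv k) f P
      rw [hP, map_zero] at this
      simpa [Matrix.vecMul, dotProduct] using this.symm
    exact fun i => congrFun (Matrix.eq_zero_of_vecMul_eq_zero h h0) i
  have hpd : ∀ i, MvPolynomial.pderiv i P = 0 := by
    intro i
    by_contra hne
    refine hmin _ ⟨hrel i, hne⟩ ?_
    change (MvPolynomial.pderiv i P).totalDegree < P.totalDegree
    by_contra hle
    rw [not_lt] at hle
    have h1 : P.totalDegree ≤ P.totalDegree - 1 := hle.trans (by
      rw [MvPolynomial.totalDegree, Finset.sup_le_iff]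
      intro m hm
      have hc : MvPolynomial.coeff (m + Finsupp.single i 1) P ≠ 0 := by
        rw [MvPolynomial.mem_support_iff, MvPolynomial.coeff_pderiv] at hm
        exact left_ne_zero_of_mul hm
      have := MvPolynomial.le_totalDegree (MvPolynomial.mem_support_iff.2 hc)
      rw [Finsupp.sum_add_index' (by simp) (by simp)] at this
      simp at this
      omega)
    have h2 : P.totalDegree = 0 := by omega
    rw [MvPolynomial.totalDegree_eq_zero_iff_eq_C] at h2
    rw [h2] at hne
    simp at hne
  have hC : P = MvPolynomial.C (MvPolynomial.coeff 0 P) := by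
    ext m
    rw [MvPolynomial.coeff_C]
    split_ifs with hm
    · rw [hm]
    · obtain ⟨i, hi⟩ : ∃ i, m i ≠ 0 := by
        by_contra! hall
        exact hm (Finsupp.ext fun i => (hall i).symm)
      have h1 := congrArg (MvPolynomial.coeff (m - Finsupp.single i 1)) (hpd i)
      rw [MvPolynomial.coeff_pderiv, MvPolynomial.coeff_zero] at h1
      have h2 : m - Finsupp.single i 1 + Finsupp.single i 1 = m := by
        ext j
        by_cases hj : i = j
        · subst hj; simp; omega
        · simp [hj]
      rw [h2] at h1
      refine (mul_eq_zero.1 h1).resolve_right ?_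
      exact Nat.cast_add_one_ne_zero _
  rw [hC, MvPolynomial.aeval_C] at hP
  have : MvPolynomial.coeff 0 P = 0 := by
    simpa using hP
  rw [this, map_zero] at hC
  exact hP0 hC

/-- In characteristic zero, a derivation of a domain into an extension field is zero if it kills a
transcendence basis: differentiate the minimal equation of any element over the basis. -/
theorem Derivation.eq_zero_of_isTranscendenceBasis {K A L ι : Type*} [Field K] [CharZero K]
    [CommRing A] [IsDomain A] [Algebra K A] [Field L] [Algebra K L] [Algebra A L]
    [IsScalarTower K A L] [FaithfulSMul A L] (D : Derivation K A L) {x : ι → A}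
    (hx : IsTranscendenceBasis K x) (hD : ∀ i, D (x i) = 0) (a : A) : D a = 0 := by
  have hR : ∀ r ∈ Algebra.adjoin K (Set.range x), D r = 0 := by
    intro r hr
    induction hr using Algebra.adjoin_induction with
    | mem y hy => obtain ⟨i, rfl⟩ := hy; exact hD i
    | algebraMap c => simp
    | add y z _ _ hy hz => simp [hy, hz]
    | mul y z _ _ hy hz => simp [hy, hz]
  let D' : Derivation (Algebra.adjoin K (Set.range x)) A L :=
    Derivation.mk' { toFun := D, map_add' := by simp, map_smul' := by
                      intro r b
                      have : r • b = (r : A) * b := rfl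
                      rw [this, Derivation.leibniz, hR r r.2, smul_zero, add_zero]
                      rfl } (fun y z => by simp)
  have halg : IsAlgebraic (Algebra.adjoin K (Set.range x)) a := hx.isAlgebraic.isAlgebraic a
  obtain ⟨p, ⟨hp0, hp⟩, hmin⟩ := (measure (Polynomial.natDegree
    (R := Algebra.adjoin K (Set.range x)))).wf.has_min
    {p | p ≠ 0 ∧ Polynomial.aeval a p = 0} halg
  have h1 := D'.map_aeval p a
  rw [hp, map_zero] at h1
  have hder : Polynomial.aeval a (Polynomial.derivative p) ≠ 0 := by
    intro h0
    have hdeg : p.natDegree ≠ 0 := by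
      intro hd
      rw [Polynomial.natDegree_eq_zero] at hd
      obtain ⟨c, rfl⟩ := hd
      rw [Polynomial.aeval_C] at hp
      have : c = 0 := Subtype.ext hp
      exact hp0 (by rw [this, map_zero])
    have : CharZero (Algebra.adjoin K (Set.range x)) :=
      charZero_of_injective_algebraMap (algebraMap K _).injective
    refine hmin _ ⟨?_, h0⟩ (Polynomial.natDegree_derivative_lt hdeg)
    intro hd
    exact hdeg (Polynomial.derivative_eq_zero.1 hd)
  have h2 : algebraMap A L (Polynomial.aeval a (Polynomial.derivative p)) * D a = 0 := by
    rw [← Algebra.smul_def]; exact h1.symm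
  exact (mul_eq_zero.1 h2).resolve_left (by
    rwa [FaithfulSMul.algebraMap_eq_zero_iff])

/-- The other direction of the Jacobian criterion: the differentials of algebraically independent
polynomials are linearly independent at a general point. -/
theorem exists_linearIndependent_jacobian {K ι σ : Type*} [Field K] [CharZero K] [Fintype σ]
    [Finite ι] (f : ι → MvPolynomial σ K) (hf : AlgebraicIndependent K f)
    {d : MvPolynomial σ K} (hd : d ≠ 0) :
    ∃ t, MvPolynomial.eval t d ≠ 0 ∧
      LinearIndependent K fun i k => MvPolynomial.eval t (MvPolynomial.pderiv k (f i)) := by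
  classical
  have := Fintype.ofFinite ι
  let A := MvPolynomial σ K
  let L := FractionRing A
  obtain ⟨B, hB, hBb⟩ := exists_isTranscendenceBasis_superset (hf.coe_range)
  have hcard := (IsTranscendenceBasis.mvPolynomial σ K).lift_cardinalMk_eq hBb
  have hBfin : Finite B := by
    rw [← Cardinal.mk_lt_aleph0_iff, ← Cardinal.lift_lt_aleph0, ← hcard, Cardinal.lift_lt_aleph0]
    exact Cardinal.mk_lt_aleph0
  have := Fintype.ofFinite B
  have hcard' : Fintype.card σ = Fintype.card B := by
    simpa using hcard
  -- extend `f` to a transcendence basis `B`; its Jacobian matrix is invertible over the field of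
  -- rational functions, since vector fields with rational coefficients are determined by
  -- their values on `B`
  let Λ : (σ → L) →ₗ[L] (B → L) :=
    Matrix.mulVecLin (Matrix.of fun b k => algebraMap A L (MvPolynomial.pderiv k (b : A)))
  have hinj : Function.Injective Λ := by
    rw [← LinearMap.ker_eq_bot, LinearMap.ker_eq_bot']
    intro c hc
    have key : ∀ a : A, MvPolynomial.mkDerivation K c a =
        ∑ k, algebraMap A L (MvPolynomial.pderiv k a) * c k := by
      intro a
      have := Derivation.map_mvAeval (MvPolynomial.mkDerivation K c) MvPolynomial.X a
      simp only [MvPolynomial.aeval_X_left, AlgHom.id_apply, MvPolynomial.mkDerivation_X] at this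
      rw [this]
      exact Finset.sum_congr rfl fun k _ => by rw [Algebra.smul_def]
    ext1 k
    have := Derivation.eq_zero_of_isTranscendenceBasis (MvPolynomial.mkDerivation K c) hBb
      (fun b => by rw [key]; exact congrFun hc b) (MvPolynomial.X k)
    rwa [MvPolynomial.mkDerivation_X] at this
  have hsurj : Function.Surjective Λ :=
    (LinearMap.injective_iff_surjective_of_finrank_eq_finrank (by simp [hcard'])).1 hinj
  -- a right inverse of the Jacobian matrix of `f`; it is defined at the points where the common
  -- denominator `e` of its entries does not vanish
  have hN : ∀ i, ∃ c : σ → L, ∀ j,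
      ∑ k, algebraMap A L (MvPolynomial.pderiv k (f j)) * c k = if i = j then 1 else 0 := by
    intro i
    obtain ⟨c, hc⟩ := hsurj (Pi.single ⟨f i, hB ⟨i, rfl⟩⟩ 1)
    refine ⟨c, fun j => ?_⟩
    have := congrFun hc ⟨f j, hB ⟨j, rfl⟩⟩
    refine this.trans ?_
    rw [Pi.single_apply]
    simp only [Subtype.mk.injEq, hf.injective.eq_iff, eq_comm]
  choose c hc using hN
  obtain ⟨⟨e, he⟩, hint⟩ := IsLocalization.exist_integer_multiples_of_finite
    (nonZeroDivisors A) (fun p : ι × σ => c p.1 p.2)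
  choose g hg using hint
  have hgrel : ∀ i j, ∑ k, g (i, k) * MvPolynomial.pderiv k (f j) = if i = j then e else 0 := by
    intro i j
    apply FaithfulSMul.algebraMap_injective A L
    rw [map_sum]
    have := congrArg (fun z => algebraMap A L e * z) (hc i j)
    simp only [Finset.mul_sum] at this
    rw [apply_ite (algebraMap A L), map_zero]
    simp only [mul_ite, mul_one, mul_zero] at this
    rw [← this]
    refine Finset.sum_congr rfl fun k _ => ?_
    rw [map_mul, hg, mul_left_comm, mul_comm, Algebra.smul_def]
  obtain ⟨t, ht⟩ := MvPolynomial.exists_eval_ne_zero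
    (mul_ne_zero hd (nonZeroDivisors.ne_zero he))
  rw [map_mul] at ht
  refine ⟨t, left_ne_zero_of_mul ht, ?_⟩
  rw [Fintype.linearIndependent_iff]
  intro a ha i
  have h1 : ∑ k, MvPolynomial.eval t (g (i, k)) *
      (∑ j, a j * MvPolynomial.eval t (MvPolynomial.pderiv k (f j))) = 0 := by
    refine Finset.sum_eq_zero fun k _ => ?_
    have := congrFun ha k
    simp only [Finset.sum_apply, Pi.smul_apply, smul_eq_mul, Pi.zero_apply] at this
    rw [this, mul_zero]
  have h2 : ∑ j, a j * MvPolynomial.eval t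
      (∑ k, g (i, k) * MvPolynomial.pderiv k (f j)) = 0 := by
    rw [← h1]
    simp only [map_sum, map_mul, Finset.mul_sum]
    rw [Finset.sum_comm]
    exact Finset.sum_congr rfl fun k _ => Finset.sum_congr rfl fun j _ => by ring
  simp only [hgrel, apply_ite (MvPolynomial.eval t), map_zero, mul_ite, mul_zero,
    Finset.sum_ite_eq, Finset.mem_univ, if_true] at h2
  exact (mul_eq_zero.1 h2).resolve_right (right_ne_zero_of_mul ht)

/-! ### Vanishing ideals in projective space -/

section Zariski

variable {K E : Type*} [Field K] [AddCommGroup E] [Module K E]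

attribute [local instance] zariskiTopology

theorem MvPolynomial.IsHomogeneous.aeval_C_mul_X {R ι : Type*} [CommRing R]
    {f : MvPolynomial ι R} {d : ℕ} (hf : f.IsHomogeneous d) (x : ι → R) :
    MvPolynomial.aeval (fun i => Polynomial.C (x i) * Polynomial.X) f =
      Polynomial.C (MvPolynomial.eval x f) * Polynomial.X ^ d := by
  rw [MvPolynomial.aeval_def, MvPolynomial.eval₂_eq, MvPolynomial.eval_eq, map_sum,
    Finset.sum_mul]
  refine Finset.sum_congr rfl fun m hm => ?_
  have hd := hf.degree_eq_sum_deg_support hm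
  simp only [mul_pow, Finset.prod_mul_distrib, Finset.prod_pow_eq_pow_sum, map_mul, map_prod,
    map_pow, Polynomial.algebraMap_eq]
  rw [hd, mul_assoc]

/-- The restriction of a polynomial in the linear forms on `E` to the line through `v`. -/
noncomputable def restrictLine (v : E) : MvPolynomial (Dual K E) K →ₐ[K] Polynomial K :=
  MvPolynomial.aeval fun φ => Polynomial.C (φ v) * Polynomial.X

theorem restrictLine_of_isHomogeneous {f : MvPolynomial (Dual K E) K} {d : ℕ}
    (hf : f.IsHomogeneous d) (v : E) : restrictLine v f =
      Polynomial.C (MvPolynomial.eval (fun φ : Dual K E => φ v) f) * Polynomial.X ^ d :=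
  hf.aeval_C_mul_X _

theorem restrictLine_eq_zero_iff_of_isHomogeneous {f : MvPolynomial (Dual K E) K} {d : ℕ}
    (hf : f.IsHomogeneous d) (v : E) :
    restrictLine v f = 0 ↔ MvPolynomial.eval (fun φ : Dual K E => φ v) f = 0 := by
  rw [restrictLine_of_isHomogeneous hf]
  simp

theorem restrictLine_eq_zero_iff {f : MvPolynomial (Dual K E) K} (v : E) :
    restrictLine v f = 0 ↔ ∀ d, MvPolynomial.eval (fun φ : Dual K E => φ v)
      (MvPolynomial.homogeneousComponent d f) = 0 := by
  constructor
  · intro h d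
    rw [← MvPolynomial.sum_homogeneousComponent f, map_sum] at h
    have h1 := congrArg (fun q => Polynomial.coeff q d) h
    simp only [restrictLine_of_isHomogeneous (MvPolynomial.homogeneousComponent_isHomogeneous _ f),
      Polynomial.finsetSum_coeff, Polynomial.coeff_C_mul_X_pow, Polynomial.coeff_zero,
      Finset.sum_ite_eq, Finset.mem_range] at h1
    split_ifs at h1 with hd
    · exact h1
    · rw [MvPolynomial.homogeneousComponent_eq_zero _ _ (by omega), map_zero]
  · intro h
    rw [← MvPolynomial.sum_homogeneousComponent f, map_sum]
    exact Finset.sum_eq_zero fun d _ =>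
      (restrictLine_eq_zero_iff_of_isHomogeneous
        (MvPolynomial.homogeneousComponent_isHomogeneous _ f) v).2 (h d)

theorem MvPolynomial.IsHomogeneous.eval_smul_forms {f : MvPolynomial (Dual K E) K} {d : ℕ}
    (hf : f.IsHomogeneous d) (c : K) (v : E) :
    MvPolynomial.eval (fun φ : Dual K E => φ (c • v)) f =
      c ^ d * MvPolynomial.eval (fun φ : Dual K E => φ v) f := by
  have h := congrArg (Polynomial.eval c) (restrictLine_of_isHomogeneous hf v)
  rw [Polynomial.eval_mul, Polynomial.eval_C, Polynomial.eval_pow, Polynomial.eval_X] at h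
  rw [mul_comm, ← h]
  clear h hf
  induction f using MvPolynomial.induction_on with
  | C a => simp [restrictLine]
  | add p q hp hq => rw [map_add, map_add, hp, hq, Polynomial.eval_add]
  | mul_X p φ hp =>
    rw [map_mul, map_mul, hp, Polynomial.eval_mul, MvPolynomial.eval_X, map_smul, smul_eq_mul,
      restrictLine, MvPolynomial.aeval_X, Polynomial.eval_mul, Polynomial.eval_C,
      Polynomial.eval_X, mul_comm c]

/-- The homogeneous ideal of the polynomials in the linear forms on `E` which vanish on a subset
of `ℙ(E)`, that is, on all lines which are elements of that set. -/
noncomputable def projVanishingIdeal (Z : Set (Projectivization K E)) :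
    Ideal (MvPolynomial (Dual K E) K) :=
  ⨅ p ∈ Z, RingHom.ker (restrictLine p.rep)

theorem mem_projVanishingIdeal {Z : Set (Projectivization K E)} {f : MvPolynomial (Dual K E) K} :
    f ∈ projVanishingIdeal Z ↔ ∀ p ∈ Z, restrictLine p.rep f = 0 := by
  simp [projVanishingIdeal, RingHom.mem_ker]

theorem projVanishingIdeal_anti {Y Z : Set (Projectivization K E)} (h : Y ⊆ Z) :
    projVanishingIdeal Z ≤ projVanishingIdeal Y := fun f hf => by
  rw [mem_projVanishingIdeal] at hf ⊢
  exact fun p hp => hf p (h hp)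

theorem isClosed_zariski_iff {Z : Set (Projectivization K E)} :
    IsClosed Z ↔ ∃ S : Set (MvPolynomial (Dual K E) K),
      (∀ f ∈ S, ∃ d : ℕ, f.IsHomogeneous d) ∧ Z = projZeroLocus K E S := by
  rw [← isOpen_compl_iff]
  change Zᶜᶜ ∈ _ ↔ _
  rw [compl_compl]
  rfl

theorem isClosed_setOf_eval_eq_zero {f : MvPolynomial (Dual K E) K} {d : ℕ}
    (hf : f.IsHomogeneous d) :
    IsClosed {p : Projectivization K E |
      MvPolynomial.eval (fun φ : Dual K E => φ p.rep) f = 0} := by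
  refine isClosed_zariski_iff.2 ⟨{f}, ?_, ?_⟩
  · rintro _ rfl
    exact ⟨d, hf⟩
  · ext p
    simp [projZeroLocus]

/-- The complements of hypersurfaces form a basis of the Zariski topology. -/
theorem exists_isHomogeneous_of_mem_isOpen {U : Set (Projectivization K E)} (hU : IsOpen U)
    {p : Projectivization K E} (hp : p ∈ U) :
    ∃ (f : MvPolynomial (Dual K E) K) (d : ℕ), f.IsHomogeneous d ∧
      MvPolynomial.eval (fun φ : Dual K E => φ p.rep) f ≠ 0 ∧
      ∀ q, MvPolynomial.eval (fun φ : Dual K E => φ q.rep) f ≠ 0 → q ∈ U := by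
  obtain ⟨S, hS, hSU⟩ := isClosed_zariski_iff.1 (isClosed_compl_iff.2 hU)
  have hp' : p ∉ projZeroLocus K E S := by
    rw [← hSU]
    exact fun h => h hp
  simp only [projZeroLocus, Set.mem_ofPred_eq, not_forall] at hp'
  obtain ⟨f, hf, hfp⟩ := hp'
  obtain ⟨d, hd⟩ := hS f hf
  refine ⟨f, d, hd, hfp, fun q hq => ?_⟩
  by_contra hqU
  have : q ∈ projZeroLocus K E S := by
    rw [← hSU]
    exact hqU
  exact hq (this f hf)

/-- The ideal of the cone over an irreducible set is prime. As the ideal is homogeneous, membership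
is tested on the homogeneous components, whose zero loci are closed. -/
theorem projVanishingIdeal_isPrime {Z : Set (Projectivization K E)}
    (hZ : IsIrreducible Z) : (projVanishingIdeal Z).IsPrime := by
  rw [Ideal.isPrime_iff]
  constructor
  · rw [Ideal.ne_top_iff_one, mem_projVanishingIdeal]
    obtain ⟨p, hp⟩ := hZ.nonempty
    intro h
    simpa using h p hp
  · intro f g hfg
    by_contra! hcon
    simp only [mem_projVanishingIdeal, not_forall, restrictLine_eq_zero_iff] at hcon
    obtain ⟨⟨p, hp, d, hd⟩, ⟨q, hq, e, he⟩⟩ := hcon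
    have hopen := fun (h : MvPolynomial (Dual K E) K) (n : ℕ) =>
      (isClosed_setOf_eval_eq_zero
        (MvPolynomial.homogeneousComponent_isHomogeneous n h)).isOpen_compl
    obtain ⟨x, hx, hx1, hx2⟩ := hZ.isPreirreducible _ _ (hopen f d) (hopen g e) ⟨p, hp, hd⟩
      ⟨q, hq, he⟩
    have h0 := mem_projVanishingIdeal.1 hfg x hx
    rw [map_mul, mul_eq_zero] at h0
    rcases h0 with h0 | h0
    · exact hx1 (restrictLine_eq_zero_iff x.rep |>.1 h0 d)
    · exact hx2 (restrictLine_eq_zero_iff x.rep |>.1 h0 e)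

end Zariski

/-! ### Dimension of the image of a homogeneous polynomial map -/

section PolyMap

/-- A homogeneous polynomial map of degree `e` from the affine space `K^σ` to the vector space `E`.
It is encoded by the pullback of linear forms; `partialDeriv t k` is the vector
`∂Φ/∂x_k (t)` of `E`. -/
structure HomogeneousPolyMap (K E σ : Type*) [Field K] [AddCommGroup E] [Module K E] (e : ℕ) where
  /-- The underlying map. -/
  toFun : (σ → K) → E
  /-- The pullback of linear forms along the map. -/
  pullback : Dual K E →ₗ[K] MvPolynomial σ K
  /-- The partial derivatives of the map. -/
  partialDeriv : (σ → K) → σ → E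
  eval_pullback : ∀ t ℓ, MvPolynomial.eval t (pullback ℓ) = ℓ (toFun t)
  isHomogeneous_pullback : ∀ ℓ, (pullback ℓ).IsHomogeneous e
  eval_pderiv_pullback : ∀ t k ℓ,
    MvPolynomial.eval t (MvPolynomial.pderiv k (pullback ℓ)) = ℓ (partialDeriv t k)

variable {K E σ τ : Type*} [Field K] [AddCommGroup E] [Module K E] {e : ℕ}

attribute [local instance] zariskiTopology

namespace HomogeneousPolyMap

/-- The set of the points `[Φ t]`, for all `t` with `Φ t ≠ 0`. -/
def projImage (Φ : HomogeneousPolyMap K E σ e) : Set (Projectivization K E) :=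
  {p | ∃ t, p.submodule = Submodule.span K {Φ.toFun t}}

/-- The pullback of polynomials in the linear forms on `E`, that is, their composition with the
map. -/
noncomputable def pullbackPoly (Φ : HomogeneousPolyMap K E σ e) :
    MvPolynomial (Dual K E) K →ₐ[K] MvPolynomial σ K :=
  MvPolynomial.aeval Φ.pullback

theorem eval_pullbackPoly (Φ : HomogeneousPolyMap K E σ e) (t : σ → K)
    (f : MvPolynomial (Dual K E) K) :
    MvPolynomial.eval t (Φ.pullbackPoly f) =
      MvPolynomial.eval (fun φ : Dual K E => φ (Φ.toFun t)) f := by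
  induction f using MvPolynomial.induction_on with
  | C a => simp [pullbackPoly]
  | add p q hp hq => rw [map_add, map_add, hp, hq, map_add]
  | mul_X p φ hp =>
    rw [map_mul, map_mul, hp, map_mul, MvPolynomial.eval_X, pullbackPoly, MvPolynomial.aeval_X,
      Φ.eval_pullback]

/-- Since `Φ` is homogeneous, the functions on `E` which vanish on its image form a homogeneous
ideal. -/
theorem pullbackPoly_homogeneousComponent (Φ : HomogeneousPolyMap K E σ e) (he : e ≠ 0)
    {f : MvPolynomial (Dual K E) K} (hf : Φ.pullbackPoly f = 0) (d : ℕ) :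
    Φ.pullbackPoly (MvPolynomial.homogeneousComponent d f) = 0 := by
  have hhom : ∀ n, (Φ.pullbackPoly (MvPolynomial.homogeneousComponent n f)).IsHomogeneous
      (e * n) := fun n =>
    (MvPolynomial.homogeneousComponent_isHomogeneous n f).aeval _ Φ.isHomogeneous_pullback
  rw [← MvPolynomial.sum_homogeneousComponent f, map_sum] at hf
  have h1 := congrArg (MvPolynomial.homogeneousComponent (e * d)) hf
  simp only [map_sum, map_zero] at h1
  by_cases hd : d ∈ Finset.range (f.totalDegree + 1)
  · rw [Finset.sum_eq_single_of_mem d hd] at h1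
    · rwa [MvPolynomial.homogeneousComponent_eq_self (hhom d)] at h1
    · intro n _ hn
      rw [MvPolynomial.homogeneousComponent_of_mem (hhom n), if_neg]
      exact fun h => hn (Nat.eq_of_mul_eq_mul_left (Nat.pos_of_ne_zero he) h).symm
  · rw [Finset.mem_range] at hd
    rw [MvPolynomial.homogeneousComponent_eq_zero _ _ (by omega), map_zero]

theorem exists_rep_eq_smul {Φ : HomogeneousPolyMap K E σ e} {p : Projectivization K E}
    {t : σ → K} (h : p.submodule = Submodule.span K {Φ.toFun t}) :
    ∃ c : K, c ≠ 0 ∧ p.rep = c • Φ.toFun t := by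
  have : p.rep ∈ p.submodule := by
    rw [p.submodule_eq]
    exact Submodule.mem_span_singleton_self _
  rw [h, Submodule.mem_span_singleton] at this
  obtain ⟨c, hc⟩ := this
  refine ⟨c, ?_, hc.symm⟩
  rintro rfl
  exact p.rep_nonzero (by rw [← hc, zero_smul])

/-- For a homogeneous polynomial, vanishing at the point `[Φ t]` can be tested on `t`. -/
theorem eval_rep_ne_zero_iff {Φ : HomogeneousPolyMap K E σ e} {p : Projectivization K E}
    {t : σ → K} (h : p.submodule = Submodule.span K {Φ.toFun t})
    {f : MvPolynomial (Dual K E) K} {d : ℕ} (hf : f.IsHomogeneous d) :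
    MvPolynomial.eval (fun φ : Dual K E => φ p.rep) f ≠ 0 ↔
      MvPolynomial.eval t (Φ.pullbackPoly f) ≠ 0 := by
  obtain ⟨c, hc, hp⟩ := exists_rep_eq_smul h
  rw [hp, hf.eval_smul_forms, eval_pullbackPoly]
  simp [hc]

theorem eval_rep_eq_zero {Φ : HomogeneousPolyMap K E σ e} {p : Projectivization K E}
    (hp : p ∈ closure Φ.projImage) {f : MvPolynomial (Dual K E) K} {d : ℕ}
    (hf : f.IsHomogeneous d) (h0 : Φ.pullbackPoly f = 0) :
    MvPolynomial.eval (fun φ : Dual K E => φ p.rep) f = 0 := by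
  refine closure_minimal ?_ (isClosed_setOf_eval_eq_zero hf) hp
  rintro q ⟨t, ht⟩
  by_contra hq
  exact (eval_rep_ne_zero_iff ht hf).1 hq (by rw [h0, map_zero])

theorem exists_mem_projImage {Φ : HomogeneousPolyMap K E σ e} {t : σ → K}
    (ht : Φ.toFun t ≠ 0) :
    ∃ p : Projectivization K E, p.submodule = Submodule.span K {Φ.toFun t} :=
  ⟨Projectivization.mk K _ ht, Projectivization.submodule_mk _ _⟩

/-- The image is irreducible because the space of parameters is. -/
theorem isIrreducible_projImage [Infinite K] (Φ : HomogeneousPolyMap K E σ e) {t₀ : σ → K}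
    (h₀ : Φ.toFun t₀ ≠ 0) : IsIrreducible Φ.projImage := by
  refine ⟨(exists_mem_projImage h₀).imp fun p hp => ⟨t₀, hp⟩, ?_⟩
  rintro U V hU hV ⟨p, ⟨t, ht⟩, hp⟩ ⟨q, ⟨s, hs⟩, hq⟩
  obtain ⟨f, d, hf, hfp, hfU⟩ := exists_isHomogeneous_of_mem_isOpen hU hp
  obtain ⟨g, d', hg, hgq, hgV⟩ := exists_isHomogeneous_of_mem_isOpen hV hq
  rw [eval_rep_ne_zero_iff ht hf] at hfp
  rw [eval_rep_ne_zero_iff hs hg] at hgq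
  obtain ⟨ℓ, hℓ⟩ : ∃ ℓ : Dual K E, ℓ (Φ.toFun t₀) ≠ 0 := by
    by_contra! hcon
    exact h₀ ((Module.forall_dual_apply_eq_zero_iff K _).1 hcon)
  rw [← Φ.eval_pullback] at hℓ
  -- a point of the parameter space where neither `f`, nor `g`, nor the map itself vanishes
  obtain ⟨u, hu⟩ := MvPolynomial.exists_eval_ne_zero
    (p := Φ.pullbackPoly f * Φ.pullbackPoly g * Φ.pullback ℓ)
    (mul_ne_zero (mul_ne_zero (fun h => hfp (by rw [h, map_zero]))
      (fun h => hgq (by rw [h, map_zero]))) (fun h => hℓ (by rw [h, map_zero])))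
  rw [map_mul, map_mul, mul_ne_zero_iff, mul_ne_zero_iff, Φ.eval_pullback] at hu
  obtain ⟨x, hx⟩ := exists_mem_projImage (Φ := Φ) (t := u)
    (fun h => hu.2 (by rw [h, map_zero]))
  exact ⟨x, ⟨u, hx⟩, hfU x ((eval_rep_ne_zero_iff hx hf).2 hu.1.1),
    hgV x ((eval_rep_ne_zero_iff hx hg).2 hu.1.2)⟩

/-- The differential of the pullback of `f` at `t` factors through the differential of `Φ`. -/
theorem exists_dual_eval_pderiv_pullbackPoly (Φ : HomogeneousPolyMap K E σ e) (t : σ → K)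
    (f : MvPolynomial (Dual K E) K) :
    ∃ μ : Dual K E, ∀ k, MvPolynomial.eval t (MvPolynomial.pderiv k (Φ.pullbackPoly f)) =
      μ (Φ.partialDeriv t k) := by
  induction f using MvPolynomial.induction_on with
  | C a => exact ⟨0, fun k => by simp [pullbackPoly]⟩
  | add p q hp hq =>
    obtain ⟨μ, hμ⟩ := hp
    obtain ⟨ν, hν⟩ := hq
    exact ⟨μ + ν, fun k => by simp [hμ, hν]⟩
  | mul_X p φ hp =>
    obtain ⟨μ, hμ⟩ := hp
    refine ⟨MvPolynomial.eval t (Φ.pullbackPoly p) • φ + φ (Φ.toFun t) • μ, fun k => ?_⟩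
    have hX : Φ.pullbackPoly (MvPolynomial.X φ) = Φ.pullback φ := by simp [pullbackPoly]
    rw [map_mul, hX, Derivation.leibniz]
    simp [hμ, Φ.eval_pderiv_pullback, Φ.eval_pullback]

/-- Algebraically independent functions on the cone over the image are at most as many as the
rank of the differential at a general point. -/
theorem card_le_of_algebraicIndependent_pullbackPoly [CharZero K] [Fintype σ]
    (Φ : HomogeneousPolyMap K E σ e) {D : MvPolynomial σ K} (hD : D ≠ 0) {n m : ℕ}
    (hn : ∀ t, MvPolynomial.eval t D ≠ 0 →
      finrank K (Submodule.span K (Set.range (Φ.partialDeriv t))) ≤ n)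
    (y : Fin m → MvPolynomial (Dual K E) K)
    (hy : AlgebraicIndependent K fun i => Φ.pullbackPoly (y i)) : m ≤ n := by
  -- at a general point the differentials are independent, and they factor through that of `Φ`
  obtain ⟨t, ht, hli⟩ := exists_linearIndependent_jacobian _ hy hD
  refine le_trans ?_ (hn t ht)
  choose μ hμ using fun i => Φ.exists_dual_eval_pderiv_pullbackPoly t (y i)
  have hfin : FiniteDimensional K (Submodule.span K (Set.range (Φ.partialDeriv t))) :=
    FiniteDimensional.span_of_finite K (Set.finite_range _)
  let T : Dual K (Submodule.span K (Set.range (Φ.partialDeriv t))) →ₗ[K] (σ → K) :=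
    LinearMap.pi fun k => Dual.eval K _ ⟨Φ.partialDeriv t k, Submodule.subset_span ⟨k, rfl⟩⟩
  have h1 : LinearIndependent K fun i =>
      (μ i).comp (Submodule.span K (Set.range (Φ.partialDeriv t))).subtype := by
    refine LinearIndependent.of_comp T ?_
    convert! hli using 1
    ext i k
    simp [T, hμ]
  have h2 := h1.fintype_card_le_finrank
  rwa [Subspace.dual_finrank_eq, Fintype.card_fin] at h2

end HomogeneousPolyMap

/-- Adjoining to a family which is algebraically independent modulo an ideal `J` an element of `J`
yields a family which is algebraically independent modulo any prime `I ≤ J` not containing the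
new element. -/
theorem eq_zero_of_aeval_cons_mem {K S : Type*} [Field K] [CommRing S] [Algebra K S] {I J : Ideal S}
    [hI : I.IsPrime] (hIJ : I ≤ J) {f : S} (hfJ : f ∈ J) (hfI : f ∉ I) {n : ℕ} {y : Fin n → S}
    (hy : ∀ P : MvPolynomial (Fin n) K, MvPolynomial.aeval y P ∈ J → P = 0)
    (P : MvPolynomial (Fin (n + 1)) K)
    (hP : MvPolynomial.aeval (Fin.cons f y : Fin (n + 1) → S) P ∈ I) : P = 0 := by
  let ev : Polynomial (MvPolynomial (Fin n) K) →+* S :=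
    Polynomial.eval₂RingHom (MvPolynomial.aeval (R := K) y).toRingHom f
  have hev : ∀ Q : MvPolynomial (Fin (n + 1)) K,
      MvPolynomial.aeval (Fin.cons f y : Fin (n + 1) → S) Q =
        ev (MvPolynomial.finSuccEquiv K n Q) := by
    intro Q
    induction Q using MvPolynomial.induction_on with
    | C a =>
      rw [← MvPolynomial.algebraMap_eq, AlgHom.commutes, AlgEquiv.commutes]
      simp [ev, IsScalarTower.algebraMap_apply K (MvPolynomial (Fin n) K) (Polynomial _)]
    | add p q hp hq => rw [map_add, hp, hq, map_add, map_add]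
    | mul_X p i hp =>
      rw [map_mul, hp, map_mul, map_mul]
      congr 1
      refine Fin.cases ?_ (fun j => ?_) i
      · simp [ev, MvPolynomial.finSuccEquiv_X_zero]
      · simp [ev, MvPolynomial.finSuccEquiv_X_succ]
  rw [hev] at hP
  by_contra hne
  have hQ : MvPolynomial.finSuccEquiv K n P ≠ 0 := by
    simpa using hne
  generalize MvPolynomial.finSuccEquiv K n P = Q at hP hQ
  -- divide by the largest possible power of the new variable, and reduce modulo `J`
  obtain ⟨R, hR, hRX⟩ := Polynomial.exists_eq_pow_rootMultiplicity_mul_and_not_dvd Q hQ 0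
  rw [hR, map_mul, map_pow] at hP
  have hX : ev (Polynomial.X - Polynomial.C 0) = f := by simp [ev]
  rw [hX] at hP
  have hRI : ev R ∈ I := (hI.mem_or_mem hP).resolve_left fun h => hfI (hI.mem_of_pow_mem _ h)
  have h0 : MvPolynomial.aeval y (R.coeff 0) ∈ J := by
    have h1 : ev R = ev R.divX * f + MvPolynomial.aeval y (R.coeff 0) := by
      conv_lhs => rw [← R.divX_mul_X_add]
      simp [ev]
    have h2 := hIJ hRI
    rw [h1] at h2
    exact (Ideal.add_mem_iff_right _ (J.mul_mem_left _ hfJ)).1 h2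
  refine hRX ?_
  rw [map_zero, sub_zero, Polynomial.X_dvd_iff]
  exact hy _ h0

theorem isIrreducible_image_val {X : Set (Projectivization K E)}
    (C : TopologicalSpace.IrreducibleCloseds X) :
    IsIrreducible (Subtype.val '' (C : Set X) : Set (Projectivization K E)) :=
  C.isIrreducible.image _ continuous_subtype_val.continuousOn

theorem exists_mem_projVanishingIdeal_of_lt {X : Set (Projectivization K E)}
    {C C' : TopologicalSpace.IrreducibleCloseds X} (h : C < C') :
    ∃ f, f ∈ projVanishingIdeal (Subtype.val '' (C : Set X)) ∧
      f ∉ projVanishingIdeal (Subtype.val '' (C' : Set X)) := by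
  obtain ⟨x, hx', hx⟩ := Set.exists_of_ssubset (SetLike.coe_ssubset_coe.2 h)
  obtain ⟨U, hU, hUC⟩ := isOpen_induced_iff.1 C.isClosed.isOpen_compl
  have hxU : x.1 ∈ U := by
    have : x ∈ Subtype.val ⁻¹' U := by
      rw [hUC]
      exact hx
    exact this
  obtain ⟨f, d, hf, hfx, hfU⟩ := exists_isHomogeneous_of_mem_isOpen hU hxU
  refine ⟨f, mem_projVanishingIdeal.2 ?_, fun hcon => ?_⟩
  · rintro _ ⟨z, hz, rfl⟩
    rw [restrictLine_eq_zero_iff_of_isHomogeneous hf]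
    by_contra hne
    have : z ∈ Subtype.val ⁻¹' U := hfU _ hne
    rw [hUC] at this
    exact this hz
  · exact hfx ((restrictLine_eq_zero_iff_of_isHomogeneous hf _).1
      (mem_projVanishingIdeal.1 hcon _ ⟨x, hx', rfl⟩))

/-- Along a chain of `n + 1` irreducible closed subsets, there are `n + 1` functions on the cone
over the largest one which are algebraically independent: a linear form which does not vanish on the
smallest one, and for each further step a function which vanishes on the smaller set but not on the
larger one. -/
theorem exists_independent_of_ltSeries [Infinite K] {X : Set (Projectivization K E)}
    (c : LTSeries (TopologicalSpace.IrreducibleCloseds X)) (n : ℕ) (hn : n < c.length + 1) :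
    ∃ y : Fin (n + 1) → MvPolynomial (Dual K E) K, ∀ P : MvPolynomial (Fin (n + 1)) K,
      MvPolynomial.aeval y P ∈ projVanishingIdeal (Subtype.val '' (c ⟨n, hn⟩ : Set X)) →
      P = 0 := by
  induction n with
  | zero =>
    obtain ⟨x, hx⟩ := (c ⟨0, hn⟩).isIrreducible.nonempty
    obtain ⟨ℓ, hℓ⟩ : ∃ ℓ : Dual K E, ℓ x.1.rep ≠ 0 := by
      by_contra! hcon
      exact x.1.rep_nonzero ((Module.forall_dual_apply_eq_zero_iff K _).1 hcon)
    refine ⟨fun _ => MvPolynomial.X ℓ, fun P hP => ?_⟩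
    have h0 := mem_projVanishingIdeal.1 hP _ ⟨x, hx, rfl⟩
    refine MvPolynomial.funext fun t => ?_
    have h1 : Polynomial.eval (t 0 / ℓ x.1.rep) (restrictLine x.1.rep
        (MvPolynomial.aeval (fun _ => MvPolynomial.X ℓ) P)) = 0 := by
      rw [h0, Polynomial.eval_zero]
    rw [map_zero, ← h1]
    clear h0 h1 hP
    induction P using MvPolynomial.induction_on with
    | C a => simp
    | add p q hp hq => rw [map_add, hp, hq, map_add, map_add, Polynomial.eval_add]
    | mul_X p i hp =>
      rw [map_mul, hp, map_mul, map_mul, Polynomial.eval_mul]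
      congr 1
      rw [MvPolynomial.eval_X, MvPolynomial.aeval_X, restrictLine, MvPolynomial.aeval_X,
        Polynomial.eval_mul, Polynomial.eval_C, Polynomial.eval_X, Fin.eq_zero i]
      field_simp
  | succ n ih =>
    obtain ⟨y, hy⟩ := ih (by omega)
    have hlt : c ⟨n, by omega⟩ < c ⟨n + 1, hn⟩ := c.strictMono (Fin.mk_lt_mk.2 (Nat.lt_succ_self n))
    obtain ⟨f, hf, hf'⟩ := exists_mem_projVanishingIdeal_of_lt hlt
    have hprime := projVanishingIdeal_isPrime (isIrreducible_image_val (c ⟨n + 1, hn⟩))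
    exact ⟨Fin.cons f y, fun P hP => eq_zero_of_aeval_cons_mem
      (projVanishingIdeal_anti (Set.image_mono hlt.le)) hf hf' hy P hP⟩

/-- The image of a polynomial map has dimension at most the rank of the differential at a general
point, minus one. The polynomial `D` describes the general points. -/
theorem zariskiDim_le_of_subset_closure_projImage [CharZero K] [Fintype σ]
    (Φ : HomogeneousPolyMap K E σ e) (he : e ≠ 0) {X : Set (Projectivization K E)}
    (hX : X ⊆ closure Φ.projImage) {D : MvPolynomial σ K} (hD : D ≠ 0) {r : ℕ}
    (hr : ∀ t, MvPolynomial.eval t D ≠ 0 →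
      finrank K (Submodule.span K (Set.range (Φ.partialDeriv t))) ≤ r + 1) :
    zariskiDim K X ≤ r := by
  refine iSup_le fun c => ?_
  obtain ⟨y, hy⟩ := exists_independent_of_ltSeries c c.length (Nat.lt_succ_self _)
  have h1 := Φ.card_le_of_algebraicIndependent_pullbackPoly hD hr y (by
    rw [algebraicIndependent_iff]
    intro P hP
    refine hy P (mem_projVanishingIdeal.2 ?_)
    rintro _ ⟨x, -, rfl⟩
    rw [restrictLine_eq_zero_iff]
    intro d
    refine HomogeneousPolyMap.eval_rep_eq_zero (hX x.2)
      (MvPolynomial.homogeneousComponent_isHomogeneous d _)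
      (Φ.pullbackPoly_homogeneousComponent he ?_ d)
    rw [← hP, ← MvPolynomial.comp_aeval_apply])
  exact_mod_cast Nat.le_of_succ_le_succ h1

end PolyMap

/-! ### Lower bounds for the dimension of the image -/

section PolyMapLower

variable {K E σ τ : Type*} [Field K] [AddCommGroup E] [Module K E] {e : ℕ}

attribute [local instance] zariskiTopology

theorem MvPolynomial.eval_aeval {R ι κ : Type*} [CommRing R] (g : ι → MvPolynomial κ R)
    (s : κ → R) (P : MvPolynomial ι R) :
    MvPolynomial.eval s (MvPolynomial.aeval g P) =
      MvPolynomial.eval (fun i => MvPolynomial.eval s (g i)) P := by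
  induction P using MvPolynomial.induction_on with
  | C a => simp
  | add p q hp hq => rw [map_add, map_add, hp, hq, map_add]
  | mul_X p i hp => rw [map_mul, map_mul, hp, map_mul, MvPolynomial.aeval_X, MvPolynomial.eval_X]

theorem LinearIndependent.exists_dual_family {ι : Type*} [Fintype ι] [DecidableEq ι] {w : ι → E}
    (hw : LinearIndependent K w) :
    ∃ y : ι → Dual K E, ∀ i j, y i (w j) = if i = j then 1 else 0 := by
  obtain ⟨g, hg⟩ := (Fintype.linearCombination K w).exists_leftInverse_of_injective
    (LinearMap.ker_eq_bot.2 ((linearIndependent_iff_injective_fintypeLinearCombination).1 hw))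
  refine ⟨fun i => (LinearMap.proj i).comp g, fun i j => ?_⟩
  have := congrFun (LinearMap.congr_fun hg (Pi.single j 1)) i
  rw [LinearMap.comp_apply, Fintype.linearCombination_apply_single, one_smul] at this
  simpa [Pi.single_apply] using this

namespace HomogeneousPolyMap

/-- The restriction of a polynomial map to a linear family of parameters, that is, its composition
with the linear map `s ↦ ∑ j, s j • u j`. -/
noncomputable def compLinear [Fintype σ] [Fintype τ] (Φ : HomogeneousPolyMap K E σ e)
    (u : τ → σ → K) : HomogeneousPolyMap K E τ e where
  toFun s := Φ.toFun (∑ j, s j • u j)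
  pullback := (MvPolynomial.aeval fun k => ∑ j, MvPolynomial.C (u j k) *
    MvPolynomial.X j : MvPolynomial σ K →ₐ[K] MvPolynomial τ K).toLinearMap ∘ₗ Φ.pullback
  partialDeriv s j := ∑ k, u j k • Φ.partialDeriv (∑ j, s j • u j) k
  eval_pullback s ℓ := by
    rw [← Φ.eval_pullback, LinearMap.comp_apply, AlgHom.toLinearMap_apply,
      MvPolynomial.eval_aeval]
    congr 2
    ext k
    simp [mul_comm]
  isHomogeneous_pullback ℓ := by
    have := (Φ.isHomogeneous_pullback ℓ).aeval (S := K) (τ := τ)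
      (fun k => ∑ j, MvPolynomial.C (u j k) * MvPolynomial.X j) (n := 1)
      (fun k => MvPolynomial.IsHomogeneous.sum _ _ _ fun j _ =>
        MvPolynomial.isHomogeneous_C_mul_X _ _)
    rwa [one_mul] at this
  eval_pderiv_pullback s j ℓ := by
    classical
    rw [LinearMap.comp_apply, AlgHom.toLinearMap_apply, Derivation.map_mvAeval, map_sum, map_sum]
    refine Finset.sum_congr rfl fun k _ => ?_
    rw [smul_eq_mul, map_mul, MvPolynomial.eval_aeval, map_smul, ← Φ.eval_pderiv_pullback,
      smul_eq_mul, mul_comm]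
    congr 1
    · rw [map_sum, map_sum, Finset.sum_eq_single j]
      · simp [MvPolynomial.pderiv_X]
      · intro i _ hi
        simp [MvPolynomial.pderiv_X, hi]
      · simp
    · congr 2
      ext k
      simp [mul_comm]

/-- Euler's identity. -/
theorem sum_smul_partialDeriv [Fintype σ] (Φ : HomogeneousPolyMap K E σ e) (t : σ → K) :
    ∑ k, t k • Φ.partialDeriv t k = (e : K) • Φ.toFun t := by
  rw [← sub_eq_zero, ← Module.forall_dual_apply_eq_zero_iff K]
  intro ℓ
  have h := congrArg (MvPolynomial.eval t) (Φ.isHomogeneous_pullback ℓ).sum_X_mul_pderiv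
  simp only [map_sum, map_mul, MvPolynomial.eval_X, Φ.eval_pderiv_pullback, map_nsmul,
    Φ.eval_pullback] at h
  simp [h]

/-- A family of independent directions extends the given parameter `t` when the differential has
sufficiently large rank. -/
theorem exists_linearIndependent_partialDeriv [Fintype σ] (w : σ → E) {t : σ → K}
    (ht : ∑ k, t k • w k ≠ 0) (n : ℕ)
    (hn : n + 1 ≤ finrank K (Submodule.span K (Set.range w))) :
    ∃ u : Fin (n + 1) → σ → K, u 0 = t ∧ LinearIndependent K fun j => ∑ k, u j k • w k := by
  induction n with
  | zero =>
    have : Subsingleton (Fin (0 + 1)) := inferInstanceAs (Subsingleton (Fin 1))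
    exact ⟨fun _ => t, rfl, LinearIndependent.of_subsingleton 0 ht⟩
  | succ n ih =>
    obtain ⟨u, hu0, hu⟩ := ih (by omega)
    obtain ⟨x, hx, hxu⟩ : ∃ x ∈ Submodule.span K (Set.range w),
        x ∉ Submodule.span K (Set.range fun j => ∑ k, u j k • w k) := by
      have hfin : FiniteDimensional K
          (Submodule.span K (Set.range fun j => ∑ k, u j k • w k)) :=
        FiniteDimensional.span_of_finite K (Set.finite_range _)
      by_contra! hcon
      have h1 := Submodule.finrank_mono (R := K) (fun x hx => hcon x hx)
      rw [finrank_span_eq_card hu, Fintype.card_fin] at h1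
      omega
    rw [Submodule.mem_span_range_iff_exists_fun] at hx
    obtain ⟨c, rfl⟩ := hx
    refine ⟨Fin.snoc u c, by rw [← hu0]; exact Fin.snoc_castSucc (α := fun _ => σ → K) c u 0, ?_⟩
    have : (fun j => ∑ k, (Fin.snoc u c : Fin (n + 2) → σ → K) j k • w k) =
        Fin.snoc (fun j => ∑ k, u j k • w k) (∑ k, c k • w k) := by
      ext j
      refine Fin.lastCases ?_ (fun i => ?_) j
      · simp
      · simp
    rw [this]
    exact linearIndependent_finSnoc.2 ⟨hu, hxu⟩

theorem pullbackPoly_rename (Φ : HomogeneousPolyMap K E σ e) {ι : Type*} (y : ι → Dual K E)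
    (P : MvPolynomial ι K) : Φ.pullbackPoly (MvPolynomial.rename y P) =
      MvPolynomial.aeval (fun i => Φ.pullback (y i)) P := by
  rw [pullbackPoly, MvPolynomial.aeval_rename]
  rfl

/-- If a polynomial map depends on fewer parameters than there are algebraically independent
functions on the cone over the image of another one, then some hypersurface contains the image of
the former but not that of the latter. -/
theorem exists_isHomogeneous_separating [Infinite K] {n m : ℕ} (hnm : n < m)
    (Φ : HomogeneousPolyMap K E (Fin n) e) (he : e ≠ 0) (Ψ : HomogeneousPolyMap K E τ e)
    (y : Fin m → Dual K E) (hy : AlgebraicIndependent K fun i => Ψ.pullback (y i))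
    {s₀ : τ → K} (h₀ : Ψ.toFun s₀ ≠ 0) :
    ∃ (f : MvPolynomial (Dual K E) K) (d : ℕ), f.IsHomogeneous d ∧
      (∀ p ∈ Φ.projImage, MvPolynomial.eval (fun φ : Dual K E => φ p.rep) f = 0) ∧
      ∃ p ∈ Ψ.projImage, MvPolynomial.eval (fun φ : Dual K E => φ p.rep) f ≠ 0 := by
  have hdep : ¬ AlgebraicIndependent K fun i => Φ.pullback (y i) := by
    intro h
    have h1 := h.lift_cardinalMk_le_trdeg
    rw [MvPolynomial.trdeg_of_isDomain] at h1
    simp at h1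
    omega
  rw [algebraicIndependent_iff] at hdep
  push Not at hdep
  obtain ⟨P, hP, hP0⟩ := hdep
  obtain ⟨d, hd⟩ : ∃ d, MvPolynomial.homogeneousComponent d P ≠ 0 := by
    by_contra! hcon
    exact hP0 (by rw [← MvPolynomial.sum_homogeneousComponent P]
                  exact Finset.sum_eq_zero fun d _ => hcon d)
  have hf : (MvPolynomial.rename y (MvPolynomial.homogeneousComponent d P)).IsHomogeneous d :=
    (MvPolynomial.homogeneousComponent_isHomogeneous d P).rename_isHomogeneous
  refine ⟨_, d, hf, ?_, ?_⟩
  · intro p hp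
    refine eval_rep_eq_zero (subset_closure hp) hf ?_
    rw [MvPolynomial.rename_homogeneousComponent]
    exact Φ.pullbackPoly_homogeneousComponent he (by rw [pullbackPoly_rename, hP]) d
  · obtain ⟨ℓ, hℓ⟩ : ∃ ℓ : Dual K E, ℓ (Ψ.toFun s₀) ≠ 0 := by
      by_contra! hcon
      exact h₀ ((Module.forall_dual_apply_eq_zero_iff K _).1 hcon)
    rw [← Ψ.eval_pullback] at hℓ
    obtain ⟨s, hs⟩ := MvPolynomial.exists_eval_ne_zero
      (p := Ψ.pullbackPoly (MvPolynomial.rename y (MvPolynomial.homogeneousComponent d P)) *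
        Ψ.pullback ℓ)
      (mul_ne_zero
        (fun h => hd (algebraicIndependent_iff.1 hy _ (by rw [← pullbackPoly_rename, h])))
        (fun h => hℓ (by rw [h, map_zero])))
    rw [map_mul, mul_ne_zero_iff, Ψ.eval_pullback] at hs
    obtain ⟨p, hp⟩ := exists_mem_projImage (Φ := Ψ) (t := s)
      (fun h => hs.2 (by rw [h, map_zero]))
    exact ⟨p, ⟨s, hp⟩, (eval_rep_ne_zero_iff hp hf).2 hs.1⟩

end HomogeneousPolyMap

/-- An increasing chain of irreducible subsets of `X` of which each is separated from the next one
by a hypersurface bounds the dimension of `X` from below. -/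
theorem le_zariskiDim_of_chain {X : Set (Projectivization K E)} {r : ℕ}
    (Y : Fin (r + 1) → Set (Projectivization K E)) (hY : ∀ i, IsIrreducible (Y i))
    (hYX : ∀ i, Y i ⊆ X) (hmono : ∀ i : Fin r, Y i.castSucc ⊆ Y i.succ)
    (hsep : ∀ i : Fin r, ∃ (f : MvPolynomial (Dual K E) K) (d : ℕ), f.IsHomogeneous d ∧
      (∀ p ∈ Y i.castSucc, MvPolynomial.eval (fun φ : Dual K E => φ p.rep) f = 0) ∧
      ∃ p ∈ Y i.succ, MvPolynomial.eval (fun φ : Dual K E => φ p.rep) f ≠ 0) :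
    (r : WithBot ℕ∞) ≤ zariskiDim K X := by
  have hirr : ∀ i, IsIrreducible (Subtype.val ⁻¹' Y i : Set X) := by
    intro i
    obtain ⟨⟨p, hp⟩, hpre⟩ := hY i
    refine ⟨⟨⟨p, hYX i hp⟩, hp⟩, ?_⟩
    rintro U V hU hV ⟨x, hx, hxU⟩ ⟨z, hz, hzV⟩
    obtain ⟨U', hU', rfl⟩ := isOpen_induced_iff.1 hU
    obtain ⟨V', hV', rfl⟩ := isOpen_induced_iff.1 hV
    obtain ⟨q, hq, hqU, hqV⟩ := hpre U' V' hU' hV' ⟨x, hx, hxU⟩ ⟨z, hz, hzV⟩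
    exact ⟨⟨q, hYX i hq⟩, hq, hqU, hqV⟩
  let C : Fin (r + 1) → TopologicalSpace.IrreducibleCloseds X := fun i =>
    ⟨closure (Subtype.val ⁻¹' Y i), (hirr i).closure, isClosed_closure⟩
  have hC : StrictMono C := by
    rw [Fin.strictMono_iff_lt_succ]
    intro i
    refine SetLike.coe_ssubset_coe.1 ⟨closure_mono (Set.preimage_mono (hmono i)), fun hle => ?_⟩
    obtain ⟨f, d, hf, h0, p, hp, hpf⟩ := hsep i
    have h1 : (⟨p, hYX _ hp⟩ : X) ∈ closure (Subtype.val ⁻¹' Y i.castSucc : Set X) :=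
      hle (subset_closure hp)
    have hcl := (isClosed_setOf_eval_eq_zero hf).preimage
      (continuous_subtype_val (p := fun x => x ∈ X))
    have h2 := hcl.closure_subset_iff.2 (fun z hz => h0 z.1 hz) h1
    rw [Set.mem_preimage, Set.mem_ofPred_eq] at h2
    exact hpf h2
  exact Order.LTSeries.length_le_krullDim ⟨r, C, fun i => hC (Fin.castSucc_lt_succ)⟩

/-- The image of a polynomial map has dimension at least the rank of the differential at a given
point, minus one: the images of an increasing sequence of linear families of parameters through
that point form a strictly increasing chain of irreducible sets. -/
theorem le_zariskiDim_of_projImage_subset [CharZero K] [Fintype σ]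
    (Φ : HomogeneousPolyMap K E σ e) (he : e ≠ 0) {X : Set (Projectivization K E)}
    (hX : Φ.projImage ⊆ X) {t : σ → K} (ht0 : Φ.toFun t ≠ 0) {r : ℕ}
    (hr : r + 1 ≤ finrank K (Submodule.span K (Set.range (Φ.partialDeriv t)))) :
    (r : WithBot ℕ∞) ≤ zariskiDim K X := by
  have ht : ∑ k, t k • Φ.partialDeriv t k ≠ 0 := by
    rw [Φ.sum_smul_partialDeriv]
    exact smul_ne_zero (Nat.cast_ne_zero.2 he) ht0
  obtain ⟨u, hu0, hu⟩ :=
    HomogeneousPolyMap.exists_linearIndependent_partialDeriv _ ht r hr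
  -- the linear families of parameters
  let Ψ : ∀ i : Fin (r + 1), HomogeneousPolyMap K E (Fin (i + 1)) e := fun i =>
    Φ.compLinear fun j => u (Fin.castLE i.2 j)
  let s : ∀ i : Fin (r + 1), Fin (i + 1) → K := fun i => Pi.single 0 1
  have hs : ∀ i, ∑ j, s i j • u (Fin.castLE i.2 j) = t := by
    intro i
    rw [Finset.sum_eq_single 0]
    · rw [← hu0]
      simp [s]
    · intro j _ hj
      simp [s, hj]
    · simp
  have hΨs : ∀ i, (Ψ i).toFun (s i) ≠ 0 := fun i => by
    change Φ.toFun (∑ j, s i j • u (Fin.castLE i.2 j)) ≠ 0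
    rwa [hs]
  have hΨX : ∀ i, (Ψ i).projImage ⊆ X := fun i p hp => hX (by
    obtain ⟨a, ha⟩ := hp
    exact ⟨_, ha⟩)
  have hmono : ∀ i : Fin r, (Ψ i.castSucc).projImage ⊆ (Ψ i.succ).projImage := by
    rintro i p ⟨a, ha⟩
    refine ⟨(Fin.snoc a 0 : Fin (i + 1 + 1) → K), ?_⟩
    rw [ha]
    congr 2
    change Φ.toFun _ = Φ.toFun _
    congr 1
    refine Eq.trans ?_ (Fin.sum_univ_castSucc (n := i + 1) _).symm
    simp
  -- functions which separate the members of the chain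
  have hsep : ∀ i : Fin r, ∃ (f : MvPolynomial (Dual K E) K) (d : ℕ), f.IsHomogeneous d ∧
      (∀ p ∈ (Ψ i.castSucc).projImage,
        MvPolynomial.eval (fun φ : Dual K E => φ p.rep) f = 0) ∧
      ∃ p ∈ (Ψ i.succ).projImage, MvPolynomial.eval (fun φ : Dual K E => φ p.rep) f ≠ 0 := by
    intro i
    have hli : LinearIndependent K
        fun j : Fin (i.succ + 1) => ∑ k, u (Fin.castLE i.succ.2 j) k • Φ.partialDeriv t k :=
      hu.comp _ (Fin.castLE_injective _)
    obtain ⟨y, hy⟩ := hli.exists_dual_family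
    refine HomogeneousPolyMap.exists_isHomogeneous_separating (by simp) (Ψ i.castSucc) he
      (Ψ i.succ) y (algebraicIndependent_of_det_jacobian_ne_zero _ fun hdet => ?_) (hΨs i.succ)
    -- at the base point the Jacobian matrix is the identity
    have h1 := congrArg (MvPolynomial.eval (s i.succ)) hdet
    rw [RingHom.map_det, map_zero] at h1
    have h2 : (MvPolynomial.eval (s i.succ)).mapMatrix (Matrix.of fun a k =>
        MvPolynomial.pderiv k ((Ψ i.succ).pullback (y a))) = 1 := by
      ext a k
      simp only [RingHom.mapMatrix_apply, Matrix.map_apply, Matrix.of_apply,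
        HomogeneousPolyMap.eval_pderiv_pullback]
      change y a (∑ l, u (Fin.castLE i.succ.2 k) l • Φ.partialDeriv
        (∑ j, s i.succ j • u (Fin.castLE i.succ.2 j)) l) = _
      rw [hs, hy, Matrix.one_apply]
    rw [h2, Matrix.det_one] at h1
    exact one_ne_zero h1
  exact le_zariskiDim_of_chain _ (fun i => (Ψ i).isIrreducible_projImage (hΨs i)) hΨX hmono hsep

end PolyMapLower

/-! ### The tangent spaces of a Grassmannian -/

section Tangent

variable {K V : Type*} [Field K] [AddCommGroup V] [Module K V]

/-- The span of the products `v₁ ∧ ⋯ ∧ vₙ` of which all factors but one lie in `H`. When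
`dim H = n`, it is the tangent space of the cone over the Grassmannian at `⋀ⁿ H`. -/
def grassmannTangent (n : ℕ) (H : Submodule K V) : Submodule K (⋀[K]^n V) :=
  Submodule.span K {x | ∃ v : Fin n → V, (∃ j, ∀ i, i ≠ j → v i ∈ H) ∧
    x = exteriorPower.ιMulti K n v}

theorem ιMulti_mem_grassmannTangent {n : ℕ} {H : Submodule K V} {v : Fin n → V} (j : Fin n)
    (hv : ∀ i, i ≠ j → v i ∈ H) : exteriorPower.ιMulti K n v ∈ grassmannTangent n H :=
  Submodule.subset_span ⟨v, ⟨j, hv⟩, rfl⟩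

/-- Two columns supported in a single common row are linearly dependent. -/
theorem Matrix.det_eq_zero_of_two_columns {R n : Type*} [CommRing R] [Fintype n] [DecidableEq n]
    (M : Matrix n n R) {j c c' : n} (hc : c ≠ c') (h : ∀ i, i ≠ j → M i c = 0)
    (h' : ∀ i, i ≠ j → M i c' = 0) : M.det = 0 := by
  rw [Matrix.det_apply]
  refine Finset.sum_eq_zero fun σ _ => ?_
  have : ∏ i, M (σ i) i = 0 := by
    by_cases hj : σ c = j
    · exact Finset.prod_eq_zero (Finset.mem_univ c')
        (h' _ fun h => hc (σ.injective (hj.trans h.symm)))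
    · exact Finset.prod_eq_zero (Finset.mem_univ c) (h _ hj)
  rw [this, smul_zero]

theorem exists_basis_of_isCompl {H C : Submodule K V} (hHC : IsCompl H C) {m n : ℕ}
    (hH : finrank K H = m) (hC : finrank K C = n) [FiniteDimensional K V] :
    ∃ b : Basis (Fin (m + n)) K V, (∀ i, b (Fin.castAdd n i) ∈ H) ∧
      (∀ i, b (Fin.natAdd m i) ∈ C) ∧ (∀ x ∈ H, ∀ i, b.coord (Fin.natAdd m i) x = 0) ∧
      ∀ x ∈ C, ∀ i, b.coord (Fin.castAdd n i) x = 0 := by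
  let bH := finBasisOfFinrankEq K H hH
  let bC := finBasisOfFinrankEq K C hC
  refine ⟨((bH.prod bC).map (Submodule.prodEquivOfIsCompl H C hHC)).reindex finSumFinEquiv,
    fun i => ?_, fun i => ?_, fun x hx i => ?_, fun x hx i => ?_⟩
  · simp
  · simp
  · have : (Submodule.prodEquivOfIsCompl H C hHC).symm x = (⟨x, hx⟩, 0) := by
      rw [LinearEquiv.symm_apply_eq]; simp
    simp [this]
  · have : (Submodule.prodEquivOfIsCompl H C hHC).symm x = (0, ⟨x, hx⟩) := by
      rw [LinearEquiv.symm_apply_eq]; simp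
    simp [this]

/-- The set of the `4`-element subsets of `Fin 8` having at least three elements among the first
four. -/
def threeLow : Set (Set.powersetCard (Fin 8) 4) :=
  {s | 3 ≤ ((s : Finset (Fin 8)).filter (· < 4)).card}

theorem ncard_threeLow : threeLow.ncard = 17 := by
  have h : Subtype.val '' threeLow =
      (((Finset.powersetCard 4 (Finset.univ : Finset (Fin 8))).filter
        fun s => 3 ≤ (s.filter (· < 4)).card : Finset (Finset (Fin 8))) : Set _) := by
    ext s
    simp [threeLow, Set.powersetCard.mem_iff, and_comm]
  rw [← Set.ncard_image_of_injective _ Subtype.val_injective, h, Set.ncard_coe_finset]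
  decide +kernel

/-- A `4`-element subset has three elements among the first four if and only if its third element in
increasing order is one of them. -/
theorem mem_threeLow_iff {s : Set.powersetCard (Fin 8) 4} :
    s ∈ threeLow ↔ Set.powersetCard.ofFinEmbEquiv.symm s 2 < 4 := by
  have hs : (s : Finset (Fin 8)).filter (· < 4) =
      (Finset.univ.filter fun i => Set.powersetCard.ofFinEmbEquiv.symm s i < 4).map
        (Set.powersetCard.ofFinEmbEquiv.symm s).toEmbedding := by
    ext x
    have := Set.powersetCard.mem_range_ofFinEmbEquiv_symm_iff_mem s x
    simp only [Finset.mem_filter, Finset.mem_map, Finset.mem_univ, true_and]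
    constructor
    · rintro ⟨hx, hx4⟩
      obtain ⟨i, rfl⟩ := this.2 hx
      exact ⟨i, hx4, rfl⟩
    · rintro ⟨i, hi, rfl⟩
      exact ⟨this.1 ⟨i, rfl⟩, hi⟩
  change 3 ≤ _ ↔ _
  rw [hs, Finset.card_map]
  generalize Set.powersetCard.ofFinEmbEquiv.symm s = g
  constructor
  · intro h
    by_contra! hg
    have hsub : (Finset.univ.filter fun i => g i < 4) ⊆ {0, 1} := by
      intro i hi
      have hi4 := (Finset.mem_filter.1 hi).2
      have hi2 : i < 2 := g.lt_iff_lt.1 (hi4.trans_le hg)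
      fin_cases i <;> simp_all
    have := Finset.card_le_card hsub
    have h2 : ({0, 1} : Finset (Fin 4)).card = 2 := rfl
    omega
  · intro h
    have hsub : ({0, 1, 2} : Finset (Fin 4)) ⊆ Finset.univ.filter fun i => g i < 4 := by
      intro i hi
      refine Finset.mem_filter.2 ⟨Finset.mem_univ _, lt_of_le_of_lt (g.monotone ?_) h⟩
      fin_cases i <;> simp_all
    exact Finset.card_le_card hsub

theorem lt_of_mem_threeLow {s : Set.powersetCard (Fin 8) 4} (hs : s ∈ threeLow) {i : Fin 4}
    (hi : i ≠ 3) : Set.powersetCard.ofFinEmbEquiv.symm s i < 4 := by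
  rw [mem_threeLow_iff] at hs
  refine lt_of_le_of_lt ((Set.powersetCard.ofFinEmbEquiv.symm s).monotone ?_) hs
  fin_cases i <;> simp_all

theorem le_of_notMem_threeLow {s : Set.powersetCard (Fin 8) 4} (hs : s ∉ threeLow) {i : Fin 4}
    (hi : 2 ≤ i) : 4 ≤ Set.powersetCard.ofFinEmbEquiv.symm s i := by
  rw [mem_threeLow_iff, not_lt] at hs
  exact hs.trans ((Set.powersetCard.ofFinEmbEquiv.symm s).monotone hi)

/-- In a basis of `V` which starts with a basis of `H`, the tangent space at `H` is spanned by basis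
vectors of `⋀⁴ V`. -/
theorem grassmannTangent_eq_span (b : Basis (Fin 8) K V) {H : Submodule K V}
    (hb : ∀ i < 4, b i ∈ H) (hb' : ∀ x ∈ H, ∀ i, 4 ≤ i → b.coord i x = 0) :
    grassmannTangent 4 H = Submodule.span K (b.exteriorPower 4 '' threeLow) := by
  apply le_antisymm
  · rw [grassmannTangent, Submodule.span_le]
    rintro _ ⟨v, ⟨j, hj⟩, rfl⟩
    rw [SetLike.mem_coe, Basis.mem_span_image]
    intro s hs
    by_contra hsl
    rw [Finset.mem_coe, Finsupp.mem_support_iff, exteriorPower.basis_repr_apply,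
      exteriorPower.ιMultiDual_apply_ιMulti] at hs
    refine hs (Matrix.det_eq_zero_of_two_columns _ (j := j) (c := 2) (c' := 3) (by decide)
      (fun i hi => ?_) (fun i hi => ?_))
    · exact hb' _ (hj i hi) _ (le_of_notMem_threeLow hsl le_rfl)
    · exact hb' _ (hj i hi) _ (le_of_notMem_threeLow hsl (by decide))
  · rw [Submodule.span_le]
    rintro _ ⟨s, hs, rfl⟩
    rw [exteriorPower.basis_apply]
    exact ιMulti_mem_grassmannTangent 3 fun i hi => hb _ (lt_of_mem_threeLow hs hi)

theorem exists_basis_fin_eight {H C : Submodule K V} (hHC : IsCompl H C)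
    (hH : finrank K H = 4) (hC : finrank K C = 4) [FiniteDimensional K V] :
    ∃ b : Basis (Fin 8) K V, (∀ i < 4, b i ∈ H) ∧ (∀ i, 4 ≤ i → b i ∈ C) ∧
      (∀ x ∈ H, ∀ i, 4 ≤ i → b.coord i x = 0) ∧ ∀ x ∈ C, ∀ i < 4, b.coord i x = 0 := by
  obtain ⟨b, h1, h2, h3, h4⟩ := exists_basis_of_isCompl hHC hH hC
  have hlow : ∀ i : Fin 8, i < 4 → ∃ k, i = Fin.castAdd 4 k := fun i hi => ⟨⟨i, hi⟩, rfl⟩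
  have hhigh : ∀ i : Fin 8, 4 ≤ i → ∃ k : Fin 4, i = Fin.natAdd 4 k := fun i hi =>
    ⟨⟨i - 4, by omega⟩, Fin.ext (by simp; have : 4 ≤ i.val := hi; omega)⟩
  refine ⟨b, fun i hi => ?_, fun i hi => ?_, fun x hx i hi => ?_, fun x hx i hi => ?_⟩
  · obtain ⟨k, rfl⟩ := hlow i hi; exact h1 k
  · obtain ⟨k, rfl⟩ := hhigh i hi; exact h2 k
  · obtain ⟨k, rfl⟩ := hhigh i hi; exact h3 x hx k
  · obtain ⟨k, rfl⟩ := hlow i hi; exact h4 x hx k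

/-- The dimension `17` is that of the cone over the `16`-dimensional Grassmannian `G(4, 8)`. -/
theorem finrank_grassmannTangent [FiniteDimensional K V] (hV : finrank K V = 8)
    {H : Submodule K V} (hH : finrank K H = 4) : finrank K (grassmannTangent 4 H) = 17 := by
  obtain ⟨C, hC⟩ := H.exists_isCompl
  have hC4 : finrank K C = 4 := by
    have := Submodule.finrank_add_eq_of_isCompl hC
    omega
  obtain ⟨b, h1, -, h3, -⟩ := exists_basis_fin_eight hC hH hC4
  rw [grassmannTangent_eq_span b h1 h3, ← ncard_threeLow]
  have := Fintype.ofFinite (b.exteriorPower 4 '' threeLow)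
  have := finrank_span_set_eq_card
    ((b.exteriorPower 4).linearIndependent.linearIndepOn_id.mono
      (Set.image_subset_range (b.exteriorPower 4) threeLow))
  rw [this, ← Set.ncard_eq_toFinset_card', Set.ncard_image_of_injective _ (Basis.injective _)]

end Tangent

/-! ### Three tangent spaces -/

section ThreeTangents

variable {K V M : Type*} [Field K] [AddCommGroup V] [Module K V] [AddCommGroup M] [Module K M]

namespace AlternatingMap

theorem vec4_add₀ (A : V [⋀^Fin 4]→ₗ[K] M) (x y b c d : V) :
    A ![x + y, b, c, d] = A ![x, b, c, d] + A ![y, b, c, d] := by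
  have h : ∀ z, Function.update ![x, b, c, d] 0 z = ![z, b, c, d] := fun z => by
    ext i
    fin_cases i <;> rfl
  simpa only [h] using A.map_update_add ![x, b, c, d] 0 x y

theorem vec4_add₁ (A : V [⋀^Fin 4]→ₗ[K] M) (a x y c d : V) :
    A ![a, x + y, c, d] = A ![a, x, c, d] + A ![a, y, c, d] := by
  have h : ∀ z, Function.update ![a, x, c, d] 1 z = ![a, z, c, d] := fun z => by
    ext i
    fin_cases i <;> rfl
  simpa only [h] using A.map_update_add ![a, x, c, d] 1 x y

theorem vec4_add₂ (A : V [⋀^Fin 4]→ₗ[K] M) (a b x y d : V) :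
    A ![a, b, x + y, d] = A ![a, b, x, d] + A ![a, b, y, d] := by
  have h : ∀ z, Function.update ![a, b, x, d] 2 z = ![a, b, z, d] := fun z => by
    ext i
    fin_cases i <;> rfl
  simpa only [h] using A.map_update_add ![a, b, x, d] 2 x y

theorem vec4_add₃ (A : V [⋀^Fin 4]→ₗ[K] M) (a b c x y : V) :
    A ![a, b, c, x + y] = A ![a, b, c, x] + A ![a, b, c, y] := by
  have h : ∀ z, Function.update ![a, b, c, x] 3 z = ![a, b, c, z] := fun z => by
    ext i
    fin_cases i <;> rfl
  simpa only [h] using A.map_update_add ![a, b, c, x] 3 x y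

theorem vec4_swap₀₁ (A : V [⋀^Fin 4]→ₗ[K] M) (a b c d : V) :
    A ![a, b, c, d] = -A ![b, a, c, d] := by
  rw [← A.map_swap ![b, a, c, d] (show (0 : Fin 4) ≠ 1 by decide)]
  congr 1
  ext i
  fin_cases i <;> rfl

theorem vec4_swap₁₂ (A : V [⋀^Fin 4]→ₗ[K] M) (a b c d : V) :
    A ![a, b, c, d] = -A ![a, c, b, d] := by
  rw [← A.map_swap ![a, c, b, d] (show (1 : Fin 4) ≠ 2 by decide)]
  congr 1
  ext i
  fin_cases i <;> rfl

theorem vec4_swap₂₃ (A : V [⋀^Fin 4]→ₗ[K] M) (a b c d : V) :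
    A ![a, b, c, d] = -A ![a, b, d, c] := by
  rw [← A.map_swap ![a, b, d, c] (show (2 : Fin 4) ≠ 3 by decide)]
  congr 1
  ext i
  fin_cases i <;> rfl

end AlternatingMap

/-- The position of the independent components of a tensor with the symmetries of a Riemannian
curvature tensor in dimension four. -/
def curvatureIndices : Finset (Fin 4 × Fin 4 × Fin 4 × Fin 4) :=
  Finset.univ.filter fun (i, j, k, l) =>
    (i = k ∧ i ≠ j ∧ i ≠ l ∧ (j < l ∨ (j = l ∧ i < j))) ∨
      (i, j, k, l) = (0, 1, 2, 3) ∨ (i, j, k, l) = (0, 2, 1, 3)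

theorem card_curvatureIndices : curvatureIndices.card = 20 := by
  decide +kernel

/-- A tensor with the symmetries of a curvature tensor in dimension four is determined by `20` of
its components. -/
theorem eq_zero_of_curvature_symmetries [CharZero K] (a : Fin 4 → Fin 4 → Fin 4 → Fin 4 → K)
    (h₁ : ∀ i j k l, a i j k l = -a j i k l) (h₂ : ∀ i j k l, a i j k l = -a i j l k)
    (hB : ∀ i j k l, a i j k l + a k i j l + a j k i l = 0)
    (h0 : ∀ i j k l, (i, j, k, l) ∈ curvatureIndices → a i j k l = 0) (i j k l : Fin 4) :
    a i j k l = 0 := by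
  -- the symmetry in the two pairs follows from the other symmetries
  have hp : ∀ i j k l, a i j k l = a k l i j := by
    intro i j k l
    -- the Bianchi identity, with each of the four indices in turn in the last place
    have e₁ : a i j k l - a i k j l + a j k i l = 0 := by
      linear_combination hB i j k l - h₁ k i j l
    have e₂ : -a i j k l - a i l j k + a j l i k = 0 := by
      linear_combination hB i j l k - h₂ i j l k - h₁ l i j k
    have e₃ : a k l i j - a i k j l + a i l j k = 0 := by
      linear_combination hB i k l j - h₂ i k l j - h₁ l i k j + h₂ i l k j
    have e₄ : -a j k i l + a j l i k - a k l i j = 0 := by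
      linear_combination hB j k l i - h₂ j k l i - h₁ l j k i + h₂ j l k i - h₂ k l j i
    linear_combination (1 / 2 : K) * (e₁ - e₃ - e₂ + e₄)
  have hz : ∀ {x : K}, x = -x → x = 0 := fun h => by
    linear_combination (1 / 2 : K) * h
  have hrep : ∀ i j k, a i j i k = 0 := by
    intro i j k
    by_cases hij : i = j
    · subst hij; exact hz (h₁ i i i k)
    by_cases hik : i = k
    · subst hik; exact hz (h₂ i j i i)
    rcases lt_trichotomy j k with h | rfl | h
    · exact h0 _ _ _ _ (by simp [curvatureIndices, hij, hik, h])
    · rcases lt_or_gt_of_ne hij with h | h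
      · exact h0 _ _ _ _ (by simp [curvatureIndices, hij, h])
      · rw [h₁, h₂, neg_neg]
        exact h0 _ _ _ _ (by simp [curvatureIndices, Ne.symm hij, h])
    · rw [hp]
      exact h0 _ _ _ _ (by simp [curvatureIndices, hij, hik, h])
  have h0123 : a 0 1 2 3 = 0 := h0 _ _ _ _ (by decide)
  have h0213 : a 0 2 1 3 = 0 := h0 _ _ _ _ (by decide)
  have h1203 : a 1 2 0 3 = 0 := by
    linear_combination hB 0 1 2 3 - h0123 - h₁ 2 0 1 3 + h0213
  have hneg₁ : ∀ {p q r s}, a p q r s = 0 → a q p r s = 0 := fun h => by rw [h₁, h, neg_zero]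
  have hneg₂ : ∀ {p q r s}, a p q r s = 0 → a p q s r = 0 := fun h => by rw [h₂, h, neg_zero]
  have hpair : ∀ {p q r s}, a p q r s = 0 → a r s p q = 0 := fun h => by rw [hp, h]
  by_cases hij : i = j
  · subst hij; exact hz (h₁ i i k l)
  by_cases hkl : k = l
  · subst hkl; exact hz (h₂ i j k k)
  by_cases hik : i = k
  · subst hik; exact hrep i j l
  by_cases hil : i = l
  · subst hil; exact hneg₂ (hrep i j k)
  by_cases hjk : j = k
  · subst hjk; exact hneg₁ (hrep j i l)
  by_cases hjl : j = l
  · subst hjl; exact hneg₁ (hneg₂ (hrep j i k))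
  -- the remaining components have four distinct indices
  have hall : ∀ p q r s, a p q r s = 0 → a q p r s = 0 ∧ a p q s r = 0 ∧ a q p s r = 0 ∧
      a r s p q = 0 ∧ a s r p q = 0 ∧ a r s q p = 0 ∧ a s r q p = 0 := fun p q r s h =>
    ⟨hneg₁ h, hneg₂ h, hneg₁ (hneg₂ h), hpair h, hneg₁ (hpair h), hneg₂ (hpair h),
      hneg₁ (hneg₂ (hpair h))⟩
  obtain ⟨u₁, u₂, u₃, u₄, u₅, u₆, u₇⟩ := hall 0 1 2 3 h0123
  obtain ⟨v₁, v₂, v₃, v₄, v₅, v₆, v₇⟩ := hall 0 2 1 3 h0213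
  obtain ⟨w₁, w₂, w₃, w₄, w₅, w₆, w₇⟩ := hall 1 2 0 3 h1203
  clear h₁ h₂ hB h0 hp hz hrep hneg₁ hneg₂ hpair hall
  fin_cases i <;> fin_cases j <;> first | exact absurd rfl hij | skip
  all_goals fin_cases k <;> first | exact absurd rfl hik | exact absurd rfl hjk | skip
  all_goals fin_cases l <;>
    first | exact absurd rfl hil | exact absurd rfl hjl | exact absurd rfl hkl | assumption

/-- A functional on `⋀⁴ V` which vanishes on the tangent spaces at `⟨e⟩`, `⟨f⟩` and `⟨e + f⟩` is
determined by the tensor of its values at `e_i ∧ e_j ∧ f_k ∧ f_l`, which has the symmetries of a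
curvature tensor: the vanishing at `⟨e + f⟩` is the first Bianchi identity. Hence `20` of its values
determine it, which bounds the codimension of the span of the tangent spaces. -/
theorem alternatingMap_eq_zero_of_three_tangents [CharZero K] (b : Basis (Fin 4 ⊕ Fin 4) K V)
    (A : V [⋀^Fin 4]→ₗ[K] K) {e f : Fin 4 → V} (he : ∀ i, b (Sum.inl i) = e i)
    (hf : ∀ i, b (Sum.inr i) = f i)
    (hE : ∀ v j, (∀ i, i ≠ j → v i ∈ Set.range e) → A v = 0)
    (hF : ∀ v j, (∀ i, i ≠ j → v i ∈ Set.range f) → A v = 0)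
    (hEF : ∀ i j k l, A ![e i + f i, e j + f j, e k + f k, f l] = 0)
    (h0 : ∀ i j k l, (i, j, k, l) ∈ curvatureIndices → A ![e i, e j, f k, f l] = 0) : A = 0 := by
  have hE' : ∀ i j k x, A ![e i, e j, e k, x] = 0 ∧ A ![e i, e j, x, e k] = 0 ∧
      A ![e i, x, e j, e k] = 0 ∧ A ![x, e i, e j, e k] = 0 := fun i j k x =>
    ⟨hE _ 3 (fun m hm => by fin_cases m <;> first | exact absurd rfl hm | exact ⟨_, rfl⟩),
      hE _ 2 (fun m hm => by fin_cases m <;> first | exact absurd rfl hm | exact ⟨_, rfl⟩),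
      hE _ 1 (fun m hm => by fin_cases m <;> first | exact absurd rfl hm | exact ⟨_, rfl⟩),
      hE _ 0 (fun m hm => by fin_cases m <;> first | exact absurd rfl hm | exact ⟨_, rfl⟩)⟩
  have hF' : ∀ i j k x, A ![f i, f j, f k, x] = 0 ∧ A ![f i, f j, x, f k] = 0 ∧
      A ![f i, x, f j, f k] = 0 ∧ A ![x, f i, f j, f k] = 0 := fun i j k x =>
    ⟨hF _ 3 (fun m hm => by fin_cases m <;> first | exact absurd rfl hm | exact ⟨_, rfl⟩),
      hF _ 2 (fun m hm => by fin_cases m <;> first | exact absurd rfl hm | exact ⟨_, rfl⟩),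
      hF _ 1 (fun m hm => by fin_cases m <;> first | exact absurd rfl hm | exact ⟨_, rfl⟩),
      hF _ 0 (fun m hm => by fin_cases m <;> first | exact absurd rfl hm | exact ⟨_, rfl⟩)⟩
  have key : ∀ i j k l, A ![e i, e j, f k, f l] = 0 := by
    refine eq_zero_of_curvature_symmetries (fun i j k l => A ![e i, e j, f k, f l])
      (fun i j k l => A.vec4_swap₀₁ _ _ _ _) (fun i j k l => A.vec4_swap₂₃ _ _ _ _)
      (fun i j k l => ?_) h0
    have h := hEF i j k l
    simp only [A.vec4_add₀, A.vec4_add₁, A.vec4_add₂, hE', hF'] at h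
    have h1 := A.vec4_swap₁₂ (e i) (f j) (e k) (f l)
    have h2 := A.vec4_swap₀₁ (f i) (e j) (e k) (f l)
    have h3 := A.vec4_swap₁₂ (e j) (f i) (e k) (f l)
    have h4 := A.vec4_swap₀₁ (e i) (e k) (f j) (f l)
    linear_combination h - h1 - h2 + h3 + h4
  refine b.ext_alternating fun v _ => ?_
  have hv : (fun i => b (v i)) = ![b (v 0), b (v 1), b (v 2), b (v 3)] := by
    ext i
    fin_cases i <;> rfl
  rw [hv, AlternatingMap.zero_apply]
  generalize v 0 = p₀, v 1 = p₁, v 2 = p₂, v 3 = p₃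
  have k₁ : ∀ i j k l, A ![e i, f j, e k, f l] = 0 := fun i j k l => by
    rw [A.vec4_swap₁₂, key, neg_zero]
  have k₂ : ∀ i j k l, A ![e i, f j, f k, e l] = 0 := fun i j k l => by
    rw [A.vec4_swap₂₃, k₁, neg_zero]
  have k₃ : ∀ i j k l, A ![f i, e j, e k, f l] = 0 := fun i j k l => by
    rw [A.vec4_swap₀₁, k₁, neg_zero]
  have k₄ : ∀ i j k l, A ![f i, e j, f k, e l] = 0 := fun i j k l => by
    rw [A.vec4_swap₀₁, k₂, neg_zero]
  have k₅ : ∀ i j k l, A ![f i, f j, e k, e l] = 0 := fun i j k l => by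
    rw [A.vec4_swap₁₂, k₄, neg_zero]
  rcases p₀ with i | i <;> rcases p₁ with j | j <;> rcases p₂ with k | k <;>
    rcases p₃ with l | l <;>
    simp only [he, hf, hE', hF', key, k₁, k₂, k₃, k₄, k₅]

/-- Three pairwise complementary subspaces of half the dimension are `⟨e⟩`, `⟨f⟩` and `⟨e + f⟩` for
a suitable basis `(e, f)`: the basis consists of the components of a basis of the third subspace
along the first two. -/
theorem exists_basis_of_three_compl [FiniteDimensional K V] {n : ℕ} (hV : finrank K V = n + n)
    {H : Fin 3 → Submodule K V} (hH : ∀ i, finrank K (H i) = n)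
    (hdisj : ∀ i j, i ≠ j → H i ⊓ H j = ⊥) :
    ∃ b : Basis (Fin n ⊕ Fin n) K V, (∀ i, b (Sum.inl i) ∈ H 0) ∧ (∀ i, b (Sum.inr i) ∈ H 1) ∧
      ∀ i, b (Sum.inl i) + b (Sum.inr i) ∈ H 2 := by
  have hc : IsCompl (H 0) (H 1) := by
    have hd : Disjoint (H 0) (H 1) := disjoint_iff.2 (hdisj 0 1 (by decide))
    refine ⟨hd, codisjoint_iff.2 (Submodule.eq_top_of_finrank_eq ?_)⟩
    have := Submodule.finrank_sup_add_finrank_inf_eq (H 0) (H 1)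
    rw [hdisj 0 1 (by decide), finrank_bot, hH, hH] at this
    omega
  let P := Submodule.prodEquivOfIsCompl (H 0) (H 1) hc
  let h := finBasisOfFinrankEq K (H 2) (hH 2)
  have hsum : ∀ x : V, ((P.symm x).1 : V) + (P.symm x).2 = x := fun x => by
    conv_rhs => rw [← P.apply_symm_apply x]
    rfl
  have hzero : ∀ x ∈ H 2, (x ∈ H 0 ∨ x ∈ H 1) → x = 0 := by
    rintro x hx2 (hx | hx)
    · have : x ∈ H 0 ⊓ H 2 := ⟨hx, hx2⟩
      rwa [hdisj 0 2 (by decide), Submodule.mem_bot] at this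
    · have : x ∈ H 1 ⊓ H 2 := ⟨hx, hx2⟩
      rwa [hdisj 1 2 (by decide), Submodule.mem_bot] at this
  have he : LinearIndependent K fun i => (P.symm (h i)).1 := by
    refine h.linearIndependent.map' ((LinearMap.fst K (H 0) (H 1)).comp
      (P.symm.toLinearMap.comp (H 2).subtype)) (LinearMap.ker_eq_bot'.2 fun x hx => ?_)
    refine Subtype.ext (hzero x x.2 (Or.inr ?_))
    have h1 := hsum x
    have h2 : (P.symm x).1 = 0 := hx
    rw [h2, Submodule.coe_zero, zero_add] at h1
    rw [← h1]
    exact Subtype.prop _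
  have hf : LinearIndependent K fun i => (P.symm (h i)).2 := by
    refine h.linearIndependent.map' ((LinearMap.snd K (H 0) (H 1)).comp
      (P.symm.toLinearMap.comp (H 2).subtype)) (LinearMap.ker_eq_bot'.2 fun x hx => ?_)
    refine Subtype.ext (hzero x x.2 (Or.inl ?_))
    have h1 := hsum x
    have h2 : (P.symm x).2 = 0 := hx
    rw [h2, Submodule.coe_zero, add_zero] at h1
    rw [← h1]
    exact Subtype.prop _
  rcases Nat.eq_zero_or_pos n with rfl | hn
  · have : Subsingleton V := finrank_zero_iff.1 hV
    exact ⟨Basis.empty V, fun i => i.elim0, fun i => i.elim0, fun i => i.elim0⟩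
  have : Nonempty (Fin n) := ⟨⟨0, hn⟩⟩
  let bE := basisOfLinearIndependentOfCardEqFinrank he (by rw [Fintype.card_fin, hH])
  let bF := basisOfLinearIndependentOfCardEqFinrank hf (by rw [Fintype.card_fin, hH])
  have hE : ∀ i, ((bE.prod bF).map P) (Sum.inl i) = (P.symm (h i)).1 := fun i => by
    simp [P, bE]
  have hF : ∀ i, ((bE.prod bF).map P) (Sum.inr i) = (P.symm (h i)).2 := fun i => by
    simp [P, bF]
  refine ⟨(bE.prod bF).map P, fun i => ?_, fun i => ?_, fun i => ?_⟩
  · rw [hE]; exact Subtype.prop _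
  · rw [hF]; exact Subtype.prop _
  · rw [hE, hF, hsum]; exact Subtype.prop _

/-- The tangent spaces to the cone over the Grassmannian `G(4, 8)` at three pairwise complementary
subspaces span a space of dimension `50`, one less than the sum of their dimensions. -/
theorem finrank_iSup_grassmannTangent [CharZero K] [FiniteDimensional K V] (hV : finrank K V = 8)
    {H : Fin 3 → Submodule K V} (hH : ∀ i, finrank K (H i) = 4)
    (hdisj : ∀ i j, i ≠ j → H i ⊓ H j = ⊥) :
    finrank K (⨆ i, grassmannTangent 4 (H i) : Submodule K (⋀[K]^4 V)) = 50 := by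
  obtain ⟨b, hE, hF, hEF⟩ := exists_basis_of_three_compl hV hH hdisj
  set e : Fin 4 → V := fun i => b (Sum.inl i) with he
  set f : Fin 4 → V := fun i => b (Sum.inr i) with hf
  have hT : ∀ i, finrank K (grassmannTangent 4 (H i)) = 17 := fun i =>
    finrank_grassmannTangent hV (hH i)
  apply le_antisymm
  · -- the tangent space at `H 2` meets the sum of the two other ones
    have hsup : (⨆ i, grassmannTangent 4 (H i)) = grassmannTangent 4 (H 0) ⊔
        grassmannTangent 4 (H 1) ⊔ grassmannTangent 4 (H 2) := by
      apply le_antisymm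
      · refine iSup_le fun i => ?_
        fin_cases i
        · exact le_sup_of_le_left le_sup_left
        · exact le_sup_of_le_left le_sup_right
        · exact le_sup_right
      · exact sup_le (sup_le (le_iSup (fun i => grassmannTangent 4 (H i)) 0)
          (le_iSup (fun i => grassmannTangent 4 (H i)) 1))
          (le_iSup (fun i => grassmannTangent 4 (H i)) 2)
    have h01 := Submodule.finrank_sup_add_finrank_inf_eq (grassmannTangent 4 (H 0))
      (grassmannTangent 4 (H 1))
    have h012 := Submodule.finrank_sup_add_finrank_inf_eq
      (grassmannTangent 4 (H 0) ⊔ grassmannTangent 4 (H 1)) (grassmannTangent 4 (H 2))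
    rw [hT, hT] at h01
    rw [hT, ← hsup] at h012
    suffices hne : (grassmannTangent 4 (H 0) ⊔ grassmannTangent 4 (H 1)) ⊓
        grassmannTangent 4 (H 2) ≠ ⊥ by
      have := Submodule.one_le_finrank_iff.2 hne
      omega
    -- for `q (x, y) = ⋀ (x e_i + y f_i)` the element `2 q - ∂q/∂y` at `(1, 1)` lies in the
    -- tangent space at `H 2`, but its terms of bidegree `(2, 2)` in `e`, `f` cancel
    let A := exteriorPower.ιMulti K 4 (M := V)
    let h : Fin 4 → V := fun i => e i + f i
    let x := (2 : K) • A ![h 0, h 1, h 2, h 3] - A ![f 0, h 1, h 2, h 3] -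
      A ![h 0, f 1, h 2, h 3] - A ![h 0, h 1, f 2, h 3] - A ![h 0, h 1, h 2, f 3]
    have hmem : ∀ (i : Fin 3) (j : Fin 4) (v : Fin 4 → V), (∀ k, k ≠ j → v k ∈ H i) →
        A v ∈ grassmannTangent 4 (H i) := fun i j v hv => ιMulti_mem_grassmannTangent j hv
    have hx : x = (2 : K) • A ![e 0, e 1, e 2, e 3] + A ![f 0, e 1, e 2, e 3] +
      A ![e 0, f 1, e 2, e 3] + A ![e 0, e 1, f 2, e 3] + A ![e 0, e 1, e 2, f 3] +
      (-A ![e 0, f 1, f 2, f 3] - A ![f 0, e 1, f 2, f 3] - A ![f 0, f 1, e 2, f 3] -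
        A ![f 0, f 1, f 2, e 3] - (2 : K) • A ![f 0, f 1, f 2, f 3]) := by
      simp only [x, h, A.vec4_add₀, A.vec4_add₁, A.vec4_add₂, A.vec4_add₃]
      module
    refine Submodule.ne_bot_iff _ |>.2 ⟨x, ⟨?_, ?_⟩, ?_⟩
    · rw [hx]
      refine Submodule.add_mem_sup ?_ ?_
      · refine add_mem (add_mem (add_mem (add_mem (Submodule.smul_mem _ _ (hmem 0 0 _ ?_))
          (hmem 0 0 _ ?_)) (hmem 0 1 _ ?_)) (hmem 0 2 _ ?_)) (hmem 0 3 _ ?_)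
        all_goals
          intro k hk
          fin_cases k <;> first | exact absurd rfl hk | exact hE _
      · refine sub_mem (sub_mem (sub_mem (sub_mem (neg_mem (hmem 1 0 _ ?_))
          (hmem 1 1 _ ?_)) (hmem 1 2 _ ?_)) (hmem 1 3 _ ?_))
          (Submodule.smul_mem _ _ (hmem 1 0 _ ?_))
        all_goals
          intro k hk
          fin_cases k <;> first | exact absurd rfl hk | exact hF _
    · refine sub_mem (sub_mem (sub_mem (sub_mem (Submodule.smul_mem _ _ (hmem 2 0 _ ?_))
          (hmem 2 0 _ ?_)) (hmem 2 1 _ ?_)) (hmem 2 2 _ ?_)) (hmem 2 3 _ ?_)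
      all_goals
        intro k hk
        fin_cases k <;> first | exact absurd rfl hk | exact hEF _
    · -- the coefficient of `e₀ ∧ e₁ ∧ e₂ ∧ e₃` is `2`
      intro h0
      let π : V →ₗ[K] (Fin 4 → K) := LinearMap.pi fun i => b.coord (Sum.inl i)
      let δ : V [⋀^Fin 4]→ₗ[K] K := Matrix.detRowAlternating.compLinearMap π
      have hδ : ∀ v, exteriorPower.alternatingMapLinearEquiv δ (A v) = δ v := fun v =>
        exteriorPower.alternatingMapLinearEquiv_apply_ιMulti δ v
      have hπf : ∀ i, π (f i) = 0 := fun i => by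
        ext j
        simp [π, hf]
      have hδ0 : ∀ (v : Fin 4 → V) (j i : Fin 4), v j = f i → δ v = 0 := fun v j i hv =>
        Matrix.det_eq_zero_of_row_eq_zero j fun k => by
          change π (v j) k = 0
          rw [hv, hπf, Pi.zero_apply]
      have hδ1 : δ ![e 0, e 1, e 2, e 3] = 1 := by
        have : (fun i => π (![e 0, e 1, e 2, e 3] i)) = (1 : Matrix (Fin 4) (Fin 4) K) := by
          ext i j
          fin_cases i <;> fin_cases j <;> simp [π, he]
        change Matrix.det (fun i => π (![e 0, e 1, e 2, e 3] i)) = 1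
        rw [this, Matrix.det_one]
      have h1 := congrArg (exteriorPower.alternatingMapLinearEquiv δ) h0
      rw [hx] at h1
      simp only [map_add, map_sub, map_neg, map_smul, hδ, hδ1, map_zero] at h1
      rw [hδ0 ![f 0, e 1, e 2, e 3] 0 0 rfl, hδ0 ![e 0, f 1, e 2, e 3] 1 1 rfl,
        hδ0 ![e 0, e 1, f 2, e 3] 2 2 rfl, hδ0 ![e 0, e 1, e 2, f 3] 3 3 rfl,
        hδ0 ![e 0, f 1, f 2, f 3] 1 1 rfl, hδ0 ![f 0, e 1, f 2, f 3] 0 0 rfl,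
        hδ0 ![f 0, f 1, e 2, f 3] 0 0 rfl, hδ0 ![f 0, f 1, f 2, e 3] 0 0 rfl,
        hδ0 ![f 0, f 1, f 2, f 3] 0 0 rfl] at h1
      simp at h1
  · -- `20` vectors span a complement, by the bound on the functionals
    let R : Submodule K (⋀[K]^4 V) := Submodule.span K (Set.range fun s : curvatureIndices =>
      exteriorPower.ιMulti K 4 ![e s.1.1, e s.1.2.1, f s.1.2.2.1, f s.1.2.2.2])
    have htop : (⨆ i, grassmannTangent 4 (H i)) ⊔ R = ⊤ := by
      by_contra hne
      obtain ⟨g, hg0, hg⟩ := Submodule.exists_le_ker_of_lt_top _ (lt_top_iff_ne_top.2 hne)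
      refine hg0 ?_
      have hgT : ∀ i v j, (∀ k, k ≠ j → v k ∈ H i) → g (exteriorPower.ιMulti K 4 v) = 0 :=
        fun i v j hv => hg (Submodule.mem_sup_left (Submodule.mem_iSup_of_mem i
          (ιMulti_mem_grassmannTangent j hv)))
      have := alternatingMap_eq_zero_of_three_tangents b
        (g.compAlternatingMap (exteriorPower.ιMulti K 4)) (fun _ => rfl) (fun _ => rfl)
        (fun v j hv => hgT 0 v j fun i hi => by obtain ⟨k, hk⟩ := hv i hi; rw [← hk]; exact hE k)
        (fun v j hv => hgT 1 v j fun i hi => by obtain ⟨k, hk⟩ := hv i hi; rw [← hk]; exact hF k)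
        (fun i j k l => hgT 2 _ 3 fun m hm => by
          fin_cases m <;> first | exact absurd rfl hm | exact hEF _)
        (fun i j k l hs => hg (Submodule.mem_sup_right (Submodule.subset_span ⟨⟨_, hs⟩, rfl⟩)))
      exact exteriorPower.linearMap_ext this
    have hR : finrank K R ≤ 20 := by
      refine (finrank_range_le_card _).trans ?_
      rw [Fintype.card_coe, card_curvatureIndices]
    have h1 := Submodule.finrank_add_le_finrank_add_finrank (⨆ i, grassmannTangent 4 (H i)) R
    rw [htop, finrank_top, exteriorPower.finrank_eq, hV] at h1
    have h2 : Nat.choose 8 4 = 70 := rfl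
    omega

end ThreeTangents

/-! ### Squares of ideals of the exterior algebra -/

section FatIntersection

variable {K V : Type*} [Field K] [AddCommGroup V] [Module K V]

theorem mul_ι_mem_exteriorIdeal {H : Submodule K V} (a : ExteriorAlgebra K V) {h : V}
    (hh : h ∈ H) : a * ExteriorAlgebra.ι K h ∈ exteriorIdeal K H :=
  Ideal.mul_mem_left _ _ (Ideal.subset_span ⟨h, hh, rfl⟩)

theorem exteriorIdeal_induction {H : Submodule K V}
    {p : (x : ExteriorAlgebra K V) → x ∈ exteriorIdeal K H → Prop}
    (zero : p 0 (zero_mem _)) (add : ∀ x y hx hy, p x hx → p y hy → p (x + y) (add_mem hx hy))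
    (mul_ι : ∀ a, ∀ h, ∀ hh : h ∈ H, p (a * ExteriorAlgebra.ι K h) (mul_ι_mem_exteriorIdeal a hh))
    {x : ExteriorAlgebra K V} (hx : x ∈ exteriorIdeal K H) : p x hx := by
  refine Submodule.closure_induction (p := p) zero add ?_ hx
  rintro a _ ⟨h, hh, rfl⟩
  exact mul_ι a h hh

/-- The left ideal generated by `H` is two-sided. -/
theorem exteriorIdeal_mul_mem_right {H : Submodule K V} (b : ExteriorAlgebra K V) :
    ∀ x ∈ exteriorIdeal K H, x * b ∈ exteriorIdeal K H := by
  induction b using ExteriorAlgebra.induction with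
  | algebraMap r =>
    intro x hx
    rw [← Algebra.commutes]
    exact Ideal.mul_mem_left _ _ hx
  | ι v =>
    intro x hx
    induction hx using exteriorIdeal_induction with
    | zero => rw [zero_mul]; exact zero_mem _
    | add x y _ _ hx hy => rw [add_mul]; exact add_mem hx hy
    | mul_ι a h hh =>
      rw [mul_assoc, eq_neg_of_add_eq_zero_left (ExteriorAlgebra.ι_add_mul_swap h v), mul_neg,
        ← mul_assoc]
      exact neg_mem (mul_ι_mem_exteriorIdeal _ hh)
  | mul a b ha hb =>
    intro x hx
    rw [← mul_assoc]
    exact hb _ (ha x hx)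
  | add a b ha hb =>
    intro x hx
    rw [mul_add]
    exact add_mem (ha x hx) (hb x hx)

theorem mul_ι_mem_exteriorIdeal_sq {H : Submodule K V} {a : ExteriorAlgebra K V}
    (ha : a ∈ exteriorIdeal K H) {h : V} (hh : h ∈ H) :
    a * ExteriorAlgebra.ι K h ∈ exteriorIdeal K H * exteriorIdeal K H :=
  Ideal.mul_mem_mul ha (Ideal.subset_span ⟨h, hh, rfl⟩)

theorem exteriorIdeal_sq_induction {H : Submodule K V}
    {p : (x : ExteriorAlgebra K V) → x ∈ exteriorIdeal K H * exteriorIdeal K H → Prop}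
    (zero : p 0 (zero_mem _)) (add : ∀ x y hx hy, p x hx → p y hy → p (x + y) (add_mem hx hy))
    (mul_ι : ∀ a, ∀ ha : a ∈ exteriorIdeal K H, ∀ h, ∀ hh : h ∈ H,
      p (a * ExteriorAlgebra.ι K h) (mul_ι_mem_exteriorIdeal_sq ha hh))
    {x : ExteriorAlgebra K V} (hx : x ∈ exteriorIdeal K H * exteriorIdeal K H) : p x hx := by
  suffices h : ∃ hx, p x hx from h.2
  refine Submodule.mul_induction_on hx (fun m hm n hn => ?_)
    fun x y ⟨hx, hpx⟩ ⟨hy, hpy⟩ => ⟨_, add x y hx hy hpx hpy⟩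
  induction hn using exteriorIdeal_induction with
  | zero => rw [mul_zero]; exact ⟨_, zero⟩
  | add x y _ _ hx hy =>
    rw [mul_add]
    exact ⟨_, add _ _ hx.1 hy.1 hx.2 hy.2⟩
  | mul_ι a h hh =>
    rw [← mul_assoc]
    exact ⟨_, mul_ι _ (exteriorIdeal_mul_mem_right a m hm) h hh⟩

/-- Contraction with a linear form which vanishes on `H` preserves the ideal generated by `H`. -/
theorem contractRight_mem_exteriorIdeal {H : Submodule K V} {d : Dual K V}
    (hd : ∀ h ∈ H, d h = 0) {x : ExteriorAlgebra K V} (hx : x ∈ exteriorIdeal K H) :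
    CliffordAlgebra.contractRight x d ∈ exteriorIdeal K H := by
  induction hx using exteriorIdeal_induction with
  | zero => rw [map_zero, LinearMap.zero_apply]; exact zero_mem _
  | add x y _ _ hx hy => rw [map_add, LinearMap.add_apply]; exact add_mem hx hy
  | mul_ι a h hh =>
    rw [ExteriorAlgebra.ι, CliffordAlgebra.contractRight_mul_ι, hd h hh, zero_smul, zero_sub]
    exact neg_mem (mul_ι_mem_exteriorIdeal _ hh)

/-- Contraction with a linear form which vanishes on `H` preserves the square of the ideal generated
by `H`. -/
theorem contractRight_mem_exteriorIdeal_sq {H : Submodule K V} {d : Dual K V}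
    (hd : ∀ h ∈ H, d h = 0) {x : ExteriorAlgebra K V}
    (hx : x ∈ exteriorIdeal K H * exteriorIdeal K H) :
    CliffordAlgebra.contractRight x d ∈ exteriorIdeal K H * exteriorIdeal K H := by
  induction hx using exteriorIdeal_sq_induction with
  | zero => rw [map_zero, LinearMap.zero_apply]; exact zero_mem _
  | add x y _ _ hx hy => rw [map_add, LinearMap.add_apply]; exact add_mem hx hy
  | mul_ι a ha h hh =>
    rw [ExteriorAlgebra.ι, CliffordAlgebra.contractRight_mul_ι, hd h hh, zero_smul, zero_sub]
    exact neg_mem (mul_ι_mem_exteriorIdeal_sq (contractRight_mem_exteriorIdeal hd ha) hh)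

/-- Contraction with any linear form maps the square of the ideal generated by `H` into that
ideal. -/
theorem contractRight_mem_exteriorIdeal_of_mem_sq {H : Submodule K V} (d : Dual K V)
    {x : ExteriorAlgebra K V} (hx : x ∈ exteriorIdeal K H * exteriorIdeal K H) :
    CliffordAlgebra.contractRight x d ∈ exteriorIdeal K H := by
  induction hx using exteriorIdeal_sq_induction with
  | zero => rw [map_zero, LinearMap.zero_apply]; exact zero_mem _
  | add x y _ _ hx hy => rw [map_add, LinearMap.add_apply]; exact add_mem hx hy
  | mul_ι a ha h hh =>
    rw [ExteriorAlgebra.ι, CliffordAlgebra.contractRight_mul_ι]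
    exact sub_mem (Submodule.smul_of_tower_mem _ _ ha) (mul_ι_mem_exteriorIdeal _ hh)

theorem algebraMapInv_eq_zero_of_mem_exteriorIdeal {H : Submodule K V}
    {x : ExteriorAlgebra K V} (hx : x ∈ exteriorIdeal K H) :
    ExteriorAlgebra.algebraMapInv x = 0 := by
  induction hx using exteriorIdeal_induction with
  | zero => exact map_zero _
  | add x y _ _ hx hy => rw [map_add, hx, hy, add_zero]
  | mul_ι a h hh => simp [ExteriorAlgebra.algebraMapInv]

theorem ιMulti_four_apply (v : Fin 4 → V) :
    ExteriorAlgebra.ιMulti K 4 v = ExteriorAlgebra.ι K (v 0) * ExteriorAlgebra.ι K (v 1) *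
      ExteriorAlgebra.ι K (v 2) * ExteriorAlgebra.ι K (v 3) := by
  rw [ExteriorAlgebra.ιMulti_apply]
  simp [List.ofFn_succ, mul_assoc]

/-- The pairing of exterior powers is an iterated contraction. -/
theorem pairingDual_ιMulti_eq_contractRight (φ : Fin 4 → Dual K V) (x : ⋀[K]^4 V) :
    exteriorPower.pairingDual K V 4 (exteriorPower.ιMulti K 4 φ) x =
      ExteriorAlgebra.algebraMapInv (CliffordAlgebra.contractRight
        (CliffordAlgebra.contractRight (CliffordAlgebra.contractRight
          (CliffordAlgebra.contractRight (x : ExteriorAlgebra K V) (φ 3)) (φ 2)) (φ 1)) (φ 0)) := by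
  let T : ⋀[K]^4 V →ₗ[K] K := ExteriorAlgebra.algebraMapInv.toLinearMap ∘ₗ
    CliffordAlgebra.contractRight.flip (φ 0) ∘ₗ CliffordAlgebra.contractRight.flip (φ 1) ∘ₗ
    CliffordAlgebra.contractRight.flip (φ 2) ∘ₗ CliffordAlgebra.contractRight.flip (φ 3) ∘ₗ
    (⋀[K]^4 V).subtype
  suffices h : exteriorPower.pairingDual K V 4 (exteriorPower.ιMulti K 4 φ) = T from
    LinearMap.congr_fun h x
  refine exteriorPower.linearMap_ext (AlternatingMap.ext fun v => ?_)
  change exteriorPower.pairingDual K V 4 _ (exteriorPower.ιMulti K 4 v) =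
    ExteriorAlgebra.algebraMapInv (CliffordAlgebra.contractRight
        (CliffordAlgebra.contractRight (CliffordAlgebra.contractRight
          (CliffordAlgebra.contractRight (ExteriorAlgebra.ιMulti K 4 v) (φ 3)) (φ 2)) (φ 1)) (φ 0))
  rw [exteriorPower.pairingDual_ιMulti_ιMulti, ιMulti_four_apply]
  simp only [ExteriorAlgebra.ι, CliffordAlgebra.contractRight_mul_ι,
    CliffordAlgebra.contractRight_ι, map_sub, map_smul, LinearMap.sub_apply,
    LinearMap.smul_apply, sub_mul, smul_mul_assoc,
    CliffordAlgebra.contractRight_algebraMap,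
    AlgHom.commutes, smul_eq_mul, Algebra.algebraMap_self_apply]
  rw [Matrix.det_succ_row_zero]
  simp [Fin.sum_univ_succ, Matrix.det_fin_three, Fin.succAbove]
  ring

/-- In degree four, the square of the ideal generated by a four-dimensional subspace `H` of an
eight-dimensional space is the orthogonal of the tangent space at `H^⊥`. -/
theorem mem_exteriorIdeal_sq_iff [FiniteDimensional K V] (hV : finrank K V = 8)
    {H : Submodule K V} (hH : finrank K H = 4) (x : ⋀[K]^4 V) :
    (x : ExteriorAlgebra K V) ∈ exteriorIdeal K H * exteriorIdeal K H ↔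
      ∀ t ∈ grassmannTangent 4 H.dualAnnihilator, exteriorPower.pairingDual K V 4 t x = 0 := by
  constructor
  · intro hx t ht
    rw [grassmannTangent] at ht
    induction ht using Submodule.span_induction with
    | zero => simp
    | add s t _ _ hs ht => simp [hs, ht]
    | smul c t _ ht => simp [ht]
    | mem t ht =>
      obtain ⟨φ, ⟨j, hφ⟩, rfl⟩ := ht
      rw [pairingDual_ιMulti_eq_contractRight]
      refine algebraMapInv_eq_zero_of_mem_exteriorIdeal (H := H) ?_
      have h : ∀ i, i ≠ j → ∀ h ∈ H, φ i h = 0 := fun i hi =>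
        (Submodule.mem_dualAnnihilator _).1 (hφ i hi)
      have h₁ := fun i hi x hx => contractRight_mem_exteriorIdeal (h i hi) (x := x) hx
      have h₂ := fun i hi x hx => contractRight_mem_exteriorIdeal_sq (h i hi) (x := x) hx
      have h₃ := fun x hx => contractRight_mem_exteriorIdeal_of_mem_sq (H := H) (φ j) (x := x) hx
      fin_cases j
      · exact h₃ _ (h₂ 1 (by decide) _ (h₂ 2 (by decide) _ (h₂ 3 (by decide) _ hx)))
      · exact h₁ 0 (by decide) _ (h₃ _ (h₂ 2 (by decide) _ (h₂ 3 (by decide) _ hx)))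
      · exact h₁ 0 (by decide) _ (h₁ 1 (by decide) _ (h₃ _ (h₂ 3 (by decide) _ hx)))
      · exact h₁ 0 (by decide) _ (h₁ 1 (by decide) _ (h₁ 2 (by decide) _ (h₃ _ hx)))
  · intro hx
    obtain ⟨C, hC⟩ := H.exists_isCompl
    have hC4 : finrank K C = 4 := by
      have := Submodule.finrank_add_eq_of_isCompl hC
      omega
    obtain ⟨b, -, h2, -, h4⟩ := exists_basis_fin_eight hC.symm hC4 hH
    change x ∈ ((exteriorIdeal K H * exteriorIdeal K H).restrictScalars K).comap (⋀[K]^4 V).subtype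
    rw [← (b.exteriorPower 4).sum_repr x]
    refine Submodule.sum_mem _ fun s _ => ?_
    by_cases hs : s ∈ threeLow
    · have : (b.exteriorPower 4).repr x s = 0 := by
        rw [exteriorPower.basis_repr_apply]
        refine hx _ (ιMulti_mem_grassmannTangent 3 fun i hi => ?_)
        rw [Submodule.mem_dualAnnihilator]
        exact fun h hh => h4 h hh _ (lt_of_mem_threeLow hs hi)
      rw [this, zero_smul]
      exact zero_mem _
    · refine Submodule.smul_mem _ _ ?_
      have hmem : ∀ i, 2 ≤ i → b (Set.powersetCard.ofFinEmbEquiv.symm s i) ∈ H := fun i hi =>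
        h2 _ (le_of_notMem_threeLow hs hi)
      rw [exteriorPower.basis_apply]
      change ExteriorAlgebra.ιMulti K 4 _ ∈ exteriorIdeal K H * exteriorIdeal K H
      rw [ιMulti_four_apply]
      exact mul_ι_mem_exteriorIdeal_sq (mul_ι_mem_exteriorIdeal _ (hmem 2 le_rfl))
        (hmem 3 (by decide))

/-- The pairing maps a basis of `⋀ⁿ V*` to the dual of a basis of `⋀ⁿ V`. -/
theorem pairingDual_injective [FiniteDimensional K V] (n : ℕ) :
    Function.Injective (exteriorPower.pairingDual K V n) := by
  let b := finBasis K V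
  have h : exteriorPower.pairingDual K V n = ((b.dualBasis.exteriorPower n).equiv
      (b.exteriorPower n).dualBasis (Equiv.refl _)).toLinearMap := by
    refine (b.dualBasis.exteriorPower n).ext fun s => ?_
    rw [LinearEquiv.coe_coe, Basis.equiv_apply, Equiv.refl_apply, exteriorPower.basis_apply,
      Basis.coe_dualBasis, Basis.coe_dualBasis, exteriorPower.basis_coord]
    rfl
  rw [h]
  exact LinearEquiv.injective _

/-- The intersection of the squares of the ideals is the orthogonal of the span of the tangent
spaces at the annihilators of the `H i`, which are again pairwise complementary, and
`70 - 50 = 20`. -/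
theorem finrank_fatIntersection_four [CharZero K] [FiniteDimensional K V] (hV : finrank K V = 8)
    {H : Fin 3 → Submodule K V} (hH : ∀ i, finrank K (H i) = 4)
    (hdisj : ∀ i j, i ≠ j → H i ⊓ H j = ⊥) : finrank K (fatIntersection K H 4) = 20 := by
  let T : Submodule K (⋀[K]^4 (Dual K V)) := ⨆ i, grassmannTangent 4 (H i).dualAnnihilator
  have hT : finrank K T = 50 := by
    refine finrank_iSup_grassmannTangent (by rw [Subspace.dual_finrank_eq, hV]) (fun i => ?_)
      fun i j hij => ?_
    · have := Subspace.finrank_add_finrank_dualAnnihilator_eq (H i)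
      rw [hH, hV] at this
      omega
    · have hsup : H i ⊔ H j = ⊤ := by
        refine Submodule.eq_top_of_finrank_eq ?_
        have := Submodule.finrank_sup_add_finrank_inf_eq (H i) (H j)
        rw [hdisj i j hij, finrank_bot, hH, hH] at this
        omega
      rw [← Submodule.dualAnnihilator_sup_eq, hsup, Submodule.dualAnnihilator_top]
  let Φ := T.map (exteriorPower.pairingDual K V 4)
  have hΦ : finrank K Φ = 50 := by
    rw [← hT]
    exact (Submodule.equivMapOfInjective _ (pairingDual_injective 4) T).finrank_eq.symm
  have hW : (fatIntersection K H 4).comap (⋀[K]^4 V).subtype = Φ.dualCoannihilator := by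
    ext x
    rw [Submodule.mem_dualCoannihilator]
    constructor
    · rintro ⟨hx, -⟩
      rw [SetLike.mem_coe, Submodule.mem_iInf] at hx
      have hle : T ≤ LinearMap.ker ((exteriorPower.pairingDual K V 4).flip x) :=
        iSup_le fun i t ht => (mem_exteriorIdeal_sq_iff hV (hH i) x).1 (hx i) t ht
      rintro _ ⟨t, ht, rfl⟩
      exact hle ht
    · intro hx
      refine ⟨?_, x.2⟩
      rw [SetLike.mem_coe, Submodule.mem_iInf]
      exact fun i => (mem_exteriorIdeal_sq_iff hV (hH i) x).2 fun t ht =>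
        hx _ ⟨t, Submodule.mem_iSup_of_mem i ht, rfl⟩
  have hle : fatIntersection K H 4 ≤ ⋀[K]^4 V := inf_le_right
  rw [← (Submodule.comapSubtypeEquivOfLe hle).finrank_eq, hW]
  have := Subspace.finrank_add_finrank_dualCoannihilator_eq Φ
  rw [hΦ, exteriorPower.finrank_eq, hV] at this
  have h2 : Nat.choose 8 4 = 70 := rfl
  omega

end FatIntersection

/-! ### The parametrization of the secant varieties -/

section Parametrization

variable {K V M : Type*} [Field K] [AddCommGroup V] [Module K V] [AddCommGroup M] [Module K M]

theorem MultilinearMap.map_sum_smul {ι κ : Type*} [Fintype ι] [DecidableEq ι] [Fintype κ]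
    (A : MultilinearMap K (fun _ : ι => V) M) (a : ι → κ → K) (u : κ → V) :
    A (fun i => ∑ k, a i k • u k) = ∑ c : ι → κ, (∏ i, a i (c i)) • A fun i => u (c i) := by
  rw [A.map_sum]
  exact Finset.sum_congr rfl fun c _ => A.map_smul_univ _ _

theorem MultilinearMap.apply_eq_sum_single {ι κ : Type*} [Fintype ι] [DecidableEq ι] [Fintype κ]
    [DecidableEq κ] (A : MultilinearMap K (fun _ : ι => κ → K) M) (v : ι → κ → K) :
    A v = ∑ c : ι → κ, (∏ i, v i (c i)) • A fun i => Pi.single (c i) 1 := by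
  rw [← A.map_sum_smul v fun k => (Pi.single k 1 : κ → K)]
  congr 1
  ext i k
  simp [Pi.single_apply]

/-- If an alternating map vanishes whenever all arguments but one are in their places in the family
`v`, it vanishes whenever all arguments but one lie in the span of `v`. -/
theorem AlternatingMap.eq_zero_of_forall_update {ι : Type*} [Fintype ι] [DecidableEq ι]
    (A : V [⋀^ι]→ₗ[K] M) {v w : ι → V} (j : ι) (hA : ∀ i x, A (Function.update v i x) = 0)
    (hw : ∀ i, i ≠ j → w i ∈ Submodule.span K (Set.range v)) : A w = 0 := by
  -- all arguments lie in the span of `v` and of the exceptional argument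
  let u : Option ι → V := fun o => o.elim (w j) v
  have hu : ∀ i, w i ∈ Submodule.span K (Set.range u) := by
    intro i
    by_cases hi : i = j
    · exact Submodule.subset_span ⟨none, by rw [hi]; rfl⟩
    · refine Submodule.span_mono ?_ (hw i hi)
      rintro _ ⟨k, rfl⟩
      exact ⟨some k, rfl⟩
  simp only [Submodule.mem_span_range_iff_exists_fun] at hu
  choose a ha using hu
  rw [← funext ha]
  refine (A.toMultilinearMap.map_sum_smul a u).trans (Finset.sum_eq_zero fun c _ => ?_)
  suffices h : A (fun i => u (c i)) = 0 from (congrArg _ h).trans (smul_zero _)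
  -- up to the order, the arguments `u ∘ c` are those of `v` with at most one replaced
  suffices h : ∃ m x, ∃ τ : ι → ι, (fun i => u (c i)) = fun i => Function.update v m x (τ i) by
    obtain ⟨m, x, τ, h⟩ := h
    rw [h]
    by_cases hτ : Function.Injective τ
    · have := A.map_perm (Function.update v m x)
        (Equiv.ofBijective τ (Finite.injective_iff_bijective.1 hτ))
      rw [hA, smul_zero] at this
      exact this
    · refine A.map_eq_zero_of_not_injective _ fun hinj => hτ fun p q hpq => hinj ?_
      simp only [hpq]
  have hc : ¬ Function.Surjective c := fun h => by
    have := Fintype.card_le_of_surjective c h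
    rw [Fintype.card_option] at this
    omega
  rw [Function.Surjective, not_forall] at hc
  obtain ⟨o, ho⟩ := hc
  rw [not_exists] at ho
  rcases o with _ | m
  · refine ⟨j, v j, fun i => (c i).getD j, funext fun i => ?_⟩
    rw [Function.update_eq_self]
    rcases hci : c i with _ | k
    · exact (ho i hci).elim
    · change v k = v ((c i).getD j)
      rw [hci]
      rfl
  · refine ⟨m, w j, fun i => (c i).getD m, funext fun i => ?_⟩
    dsimp only
    rcases hci : c i with _ | k
    · simp [u]
    · have : k ≠ m := fun h => ho i (h ▸ hci)
      simp [u, this]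

/-- The tangent space at `⟨v⟩` is already spanned by the products in which a single factor of
`v₁ ∧ ⋯ ∧ vₙ` is replaced. This does not require `v` to be linearly independent. -/
theorem grassmannTangent_span_range {n : ℕ} (v : Fin n → V) :
    grassmannTangent n (Submodule.span K (Set.range v)) = Submodule.span K
      (Set.range fun q : Fin n × V => exteriorPower.ιMulti K n (Function.update v q.1 q.2)) := by
  refine le_antisymm (Submodule.span_le.2 ?_) (Submodule.span_le.2 ?_)
  · rintro _ ⟨w, ⟨j, hw⟩, rfl⟩
    rw [SetLike.mem_coe, ← Submodule.ker_mkQ (Submodule.span K _), LinearMap.mem_ker]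
    refine AlternatingMap.eq_zero_of_forall_update
      ((Submodule.mkQ _).compAlternatingMap (exteriorPower.ιMulti K n)) j (fun i x => ?_) hw
    rw [LinearMap.compAlternatingMap_apply, ← LinearMap.mem_ker, Submodule.ker_mkQ]
    exact Submodule.subset_span ⟨(i, x), rfl⟩
  · rintro _ ⟨⟨j, x⟩, rfl⟩
    refine ιMulti_mem_grassmannTangent j fun i hi => ?_
    dsimp only
    rw [Function.update_of_ne hi]
    exact Submodule.subset_span ⟨i, rfl⟩

theorem Derivation.leibniz_prod {R A N ι : Type*} [CommSemiring R] [CommSemiring A]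
    [AddCommMonoid N] [Algebra R A] [Module A N] [Module R N] [DecidableEq ι]
    (D : Derivation R A N) (s : Finset ι) (f : ι → A) :
    D (∏ i ∈ s, f i) = ∑ i ∈ s, (∏ j ∈ s.erase i, f j) • D (f i) := by
  induction s using Finset.induction_on with
  | empty => simp
  | insert a s ha ih =>
    rw [Finset.prod_insert ha, D.leibniz, ih, Finset.sum_insert ha, Finset.erase_insert ha,
      Finset.smul_sum, add_comm]
    refine congrArg _ (Finset.sum_congr rfl fun i hi => ?_)
    have hia : i ≠ a := fun h => ha (h ▸ hi)
    rw [Finset.erase_insert_of_ne hia.symm,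
      Finset.prod_insert fun h => ha (Finset.mem_of_mem_erase h), mul_smul]

theorem MvPolynomial.pderiv_prod_X {ι σ : Type*} [Fintype ι] [DecidableEq ι] [DecidableEq σ]
    (x : ι → σ) (k : σ) : MvPolynomial.pderiv k (∏ i, (MvPolynomial.X (x i) : MvPolynomial σ K)) =
      ∑ i, if x i = k then ∏ j ∈ Finset.univ.erase i, MvPolynomial.X (x j) else 0 := by
  rw [Derivation.leibniz_prod]
  refine Finset.sum_congr rfl fun i _ => ?_
  by_cases h : x i = k
  · simp [h]
  · simp [h]

/-- The polynomial map which sends `s` families of `n` vectors of `K^κ` to the sum of the `s` wedge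
products of the families. The coordinate `(i, j, c)` of a parameter is the `c`-th entry of the
`j`-th vector of the `i`-th family. -/
noncomputable def sumWedge (K κ : Type*) [Field K] [Fintype κ] [DecidableEq κ] (s n : ℕ) :
    HomogeneousPolyMap K (⋀[K]^n (κ → K)) (Fin s × Fin n × κ) n where
  toFun t := ∑ i, exteriorPower.ιMulti K n fun j c => t (i, j, c)
  pullback :=
    { toFun := fun ℓ => ∑ i, ∑ c : Fin n → κ,
        ℓ (exteriorPower.ιMulti K n fun j => Pi.single (c j) 1) •
          ∏ j, MvPolynomial.X (i, j, c j)
      map_add' := fun ℓ m => by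
        simp only [LinearMap.add_apply, add_smul, Finset.sum_add_distrib]
      map_smul' := fun a ℓ => by
        simp only [LinearMap.smul_apply, smul_eq_mul, mul_smul, Finset.smul_sum,
          RingHom.id_apply] }
  partialDeriv t k := exteriorPower.ιMulti K n
    (Function.update (fun j c => t (k.1, j, c)) k.2.1 (Pi.single k.2.2 1))
  eval_pullback t ℓ := by
    simp only [LinearMap.coe_mk, AddHom.coe_mk, map_sum]
    refine Finset.sum_congr rfl fun i _ => ?_
    refine Eq.trans ?_ ((ℓ.compAlternatingMap (exteriorPower.ιMulti K n)).toMultilinearMap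
      |>.apply_eq_sum_single fun j c => t (i, j, c)).symm
    refine Finset.sum_congr rfl fun c _ => ?_
    rw [MvPolynomial.smul_eval, map_prod, smul_eq_mul, mul_comm]
    simp
  isHomogeneous_pullback ℓ := by
    refine MvPolynomial.IsHomogeneous.sum _ _ _ fun i _ => MvPolynomial.IsHomogeneous.sum _ _ _
      fun c _ => ?_
    rw [MvPolynomial.smul_eq_C_mul]
    refine MvPolynomial.IsHomogeneous.C_mul ?_ _
    have := MvPolynomial.IsHomogeneous.prod (R := K) Finset.univ
      (fun j : Fin n => MvPolynomial.X (i, j, c j)) (fun _ => 1)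
      fun j _ => MvPolynomial.isHomogeneous_X K _
    simpa using this
  eval_pderiv_pullback t k ℓ := by
    obtain ⟨i₀, j₀, c₀⟩ := k
    simp only [LinearMap.coe_mk, AddHom.coe_mk, map_sum]
    rw [Finset.sum_eq_single i₀]
    · refine Eq.trans ?_ ((ℓ.compAlternatingMap (exteriorPower.ιMulti K n)).toMultilinearMap
        |>.apply_eq_sum_single _).symm
      refine Finset.sum_congr rfl fun c _ => ?_
      rw [Derivation.map_smul, MvPolynomial.smul_eval, MvPolynomial.pderiv_prod_X, map_sum,
        Finset.sum_eq_single j₀, ← Finset.mul_prod_erase _ _ (Finset.mem_univ j₀),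
        Function.update_self, smul_eq_mul, mul_comm]
      · by_cases h : c j₀ = c₀
        · rw [if_pos (by rw [h]), map_prod, h, Pi.single_eq_same, one_mul]
          refine congrArg₂ _ (Finset.prod_congr rfl fun j hj => ?_) rfl
          rw [Function.update_of_ne (Finset.ne_of_mem_erase hj), MvPolynomial.eval_X]
        · rw [if_neg (by simp [h]), Pi.single_eq_of_ne h, zero_mul, map_zero, zero_mul, zero_mul]
      · intro j _ hj
        rw [if_neg (by simp [hj]), map_zero]
      · simp
    · intro i _ hi
      refine Finset.sum_eq_zero fun c _ => ?_
      rw [Derivation.map_smul, MvPolynomial.pderiv_prod_X, Finset.sum_eq_zero, smul_zero, map_zero]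
      intro j _
      rw [if_neg (by simp [hi])]
    · simp

variable {κ : Type*} [Fintype κ] [DecidableEq κ]

theorem sumWedge_toFun {s n : ℕ} (t : Fin s × Fin n × κ → K) :
    (sumWedge K κ s n).toFun t = ∑ i, exteriorPower.ιMulti K n fun j c => t (i, j, c) := rfl

/-- The linear span of the partial derivatives of the sum of wedge products is the sum of the
tangent spaces of the Grassmannian (Terracini's lemma). -/
theorem span_range_partialDeriv_sumWedge {s n : ℕ} (t : Fin s × Fin n × κ → K) :
    Submodule.span K (Set.range ((sumWedge K κ s n).partialDeriv t)) =
      ⨆ i, grassmannTangent n (Submodule.span K (Set.range fun j c => t (i, j, c))) := by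
  simp only [grassmannTangent_span_range, ← Submodule.span_iUnion]
  refine le_antisymm (Submodule.span_mono ?_) (Submodule.span_le.2 ?_)
  · rintro _ ⟨⟨i, j, c⟩, rfl⟩
    exact Set.mem_iUnion.2 ⟨i, (j, _), rfl⟩
  · refine Set.iUnion_subset fun i => ?_
    rintro _ ⟨⟨j, x⟩, rfl⟩
    have hx : x = ∑ c, x c • Pi.single c (1 : K) := by
      ext k
      simp [Pi.single_apply]
    rw [SetLike.mem_coe]
    dsimp only
    rw [hx, ← AlternatingMap.coe_multilinearMap, MultilinearMap.map_update_sum]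
    refine Submodule.sum_mem _ fun c _ => ?_
    rw [MultilinearMap.map_update_smul]
    exact Submodule.smul_mem _ _ (Submodule.subset_span ⟨(i, j, c), rfl⟩)

theorem pluckerGrassmannian_eq_projImage (n : ℕ) :
    pluckerGrassmannian K n (κ → K) = (sumWedge K κ 1 n).projImage := by
  ext p
  constructor
  · rintro ⟨v, -, hp⟩
    refine ⟨fun k => v k.2.1 k.2.2, ?_⟩
    rw [hp, sumWedge_toFun, Fin.sum_univ_one]
  · rintro ⟨t, hp⟩
    replace hp : p.submodule =
        Submodule.span K {exteriorPower.ιMulti K n fun j c => t (0, j, c)} := by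
      rw [hp, sumWedge_toFun, Fin.sum_univ_one]
    refine ⟨_, ?_, hp⟩
    by_contra hli
    rw [AlternatingMap.map_linearDependent _ _ hli, Submodule.span_zero_singleton] at hp
    have := p.finrank_submodule
    rw [hp, finrank_bot] at this
    exact zero_ne_one this

/-- The union of the linear spaces spanned by `s` points of the Grassmannian is the set of the
classes of sums of `s` wedge products. -/
theorem secant_pluckerGrassmannian_eq_projImage (s : ℕ) {n : ℕ} (hn : 0 < n) :
    {p : Projectivization K (⋀[K]^n (κ → K)) | ∃ x : Fin s → Projectivization K _,
      (∀ i, x i ∈ pluckerGrassmannian K n (κ → K)) ∧ p.submodule ≤ ⨆ i, (x i).submodule} =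
      (sumWedge K κ s n).projImage := by
  ext p
  constructor
  · rintro ⟨x, hx, hp⟩
    choose v hv hxv using hx
    simp only [hxv, ← Submodule.span_iUnion, Set.iUnion_singleton_eq_range] at hp
    rw [p.submodule_eq, Submodule.span_singleton_le_iff_mem,
      Submodule.mem_span_range_iff_exists_fun] at hp
    obtain ⟨a, ha⟩ := hp
    -- the coefficients are absorbed by the first vectors of the families
    let w : Fin s → Fin n → κ → K := fun i =>
      Function.update (v i) ⟨0, hn⟩ (a i • v i ⟨0, hn⟩)
    have hw : ∀ i, exteriorPower.ιMulti K n (w i) = a i • exteriorPower.ιMulti K n (v i) := by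
      intro i
      rw [AlternatingMap.map_update_smul, Function.update_eq_self]
    refine ⟨fun k => w k.1 k.2.1 k.2.2, ?_⟩
    rw [p.submodule_eq, ← ha, sumWedge_toFun]
    simp only [← hw]
  · rintro ⟨t, hp⟩
    replace hp : p.submodule = Submodule.span K
      {∑ i : Fin s, exteriorPower.ιMulti K n fun j c => t (i, j, c)} := hp
    have hmem : ∀ i, (exteriorPower.ιMulti K n fun j c => t (i, j, c)) ≠ 0 →
        ∃ x ∈ pluckerGrassmannian K n (κ → K),
          (exteriorPower.ιMulti K n fun j c => t (i, j, c)) ∈ x.submodule := by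
      intro i hi
      refine ⟨Projectivization.mk K _ hi, ⟨_, ?_, Projectivization.submodule_mk _ _⟩, ?_⟩
      · by_contra hli
        exact hi (AlternatingMap.map_linearDependent _ _ hli)
      · rw [Projectivization.submodule_mk]
        exact Submodule.mem_span_singleton_self _
    -- some summand is nonzero; it serves in place of the summands which are zero
    obtain ⟨i₀, hi₀⟩ : ∃ i, (exteriorPower.ιMulti K n fun j c => t (i, j, c)) ≠ 0 := by
      by_contra! h
      rw [Finset.sum_eq_zero fun i _ => h i, Submodule.span_zero_singleton] at hp
      have := p.finrank_submodule
      rw [hp, finrank_bot] at this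
      exact zero_ne_one this
    obtain ⟨x₀, hx₀, -⟩ := hmem i₀ hi₀
    have hall : ∀ i, ∃ x ∈ pluckerGrassmannian K n (κ → K),
        (exteriorPower.ιMulti K n fun j c => t (i, j, c)) ∈ x.submodule := by
      intro i
      by_cases hi : (exteriorPower.ιMulti K n fun j c => t (i, j, c)) = 0
      · exact ⟨x₀, hx₀, hi ▸ Submodule.zero_mem _⟩
      · exact hmem i hi
    choose x hx hxt using hall
    refine ⟨x, hx, ?_⟩
    rw [hp, Submodule.span_singleton_le_iff_mem]
    exact Submodule.sum_mem _ fun i _ => (le_iSup (fun i => (x i).submodule) i) (hxt i)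

end Parametrization

/-! ### Generic four-dimensional subspaces -/

section Generic

/-- The matrix whose rows are the vectors of two families of four vectors each. -/
def stackMatrix {R : Type*} (u v : Fin 4 → Fin 8 → R) : Matrix (Fin 8) (Fin 8) R :=
  Matrix.of fun r => Sum.elim u v ((finSumFinEquiv (m := 4) (n := 4)).symm r)

theorem map_det_stackMatrix {R S : Type*} [CommRing R] [CommRing S] (f : R →+* S)
    (u v : Fin 4 → Fin 8 → R) : f (stackMatrix u v).det =
      (stackMatrix (fun j c => f (u j c)) fun j c => f (v j c)).det := by
  rw [RingHom.map_det]
  congr 1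
  ext r c
  simp only [RingHom.mapMatrix_apply, Matrix.map_apply, stackMatrix, Matrix.of_apply]
  rcases (finSumFinEquiv (m := 4) (n := 4)).symm r with j | j <;> rfl

variable {K : Type*} [Field K]

theorem det_stackMatrix_ne_zero_iff {u v : Fin 4 → Fin 8 → K} :
    (stackMatrix u v).det ≠ 0 ↔ LinearIndependent K (Sum.elim u v) := by
  rw [← isUnit_iff_ne_zero, ← Matrix.isUnit_iff_isUnit_det,
    ← Matrix.linearIndependent_rows_iff_isUnit]
  exact linearIndependent_equiv (finSumFinEquiv (m := 4) (n := 4)).symm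

/-- The family of the four vectors `α • e_j + β • e_(4 + j)` of `K⁸`. -/
def pencil (α β : K) : Fin 4 → Fin 8 → K := fun j c =>
  Sum.elim (fun i => if i = j then α else 0) (fun i => if i = j then β else 0)
    ((finSumFinEquiv (m := 4) (n := 4)).symm c)

theorem pencil_castAdd (α β : K) (i j : Fin 4) :
    pencil α β j (Fin.castAdd 4 i) = if i = j then α else 0 := by
  rw [pencil, finSumFinEquiv_symm_apply_castAdd, Sum.elim_inl]

theorem pencil_natAdd (α β : K) (i j : Fin 4) :
    pencil α β j (Fin.natAdd 4 i) = if i = j then β else 0 := by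
  rw [pencil, finSumFinEquiv_symm_apply_natAdd, Sum.elim_inr]

theorem linearIndependent_pencil {α β γ δ : K} (h : α * δ - β * γ ≠ 0) :
    LinearIndependent K (Sum.elim (pencil α β) (pencil γ δ)) := by
  rw [Fintype.linearIndependent_iff]
  intro g hg
  have h1 : ∀ i, g (.inl i) * α + g (.inr i) * γ = 0 := fun i => by
    have := congrFun hg (Fin.castAdd 4 i)
    simpa [-Fin.natAdd_eq_addNat, Finset.sum_apply, pencil_castAdd] using this
  have h2 : ∀ i, g (.inl i) * β + g (.inr i) * δ = 0 := fun i => by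
    have := congrFun hg (Fin.natAdd 4 i)
    simpa [-Fin.natAdd_eq_addNat, Finset.sum_apply, pencil_natAdd] using this
  rintro (i | i)
  · exact (mul_eq_zero.1 (by linear_combination δ * h1 i - γ * h2 i :
      (α * δ - β * γ) * g (.inl i) = 0)).resolve_left h
  · exact (mul_eq_zero.1 (by linear_combination α * h2 i - β * h1 i :
      (α * δ - β * γ) * g (.inr i) = 0)).resolve_left h

/-- The alternating form of degree four in the first four coordinates separates sums of powers:
it takes the value `α ^ 4` at `pencil α β`. -/
theorem exists_dual_ιMulti_pencil : ∃ ℓ : Dual K (⋀[K]^4 (Fin 8 → K)),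
    ∀ α β : K, ℓ (exteriorPower.ιMulti K 4 (pencil α β)) = α ^ 4 := by
  refine ⟨exteriorPower.alternatingMapLinearEquiv ((Matrix.detRowAlternating (R := K)
    (n := Fin 4)).compLinearMap (LinearMap.funLeft K K (Fin.castAdd 4))), fun α β => ?_⟩
  rw [exteriorPower.alternatingMapLinearEquiv_apply_ιMulti]
  have : (fun j => LinearMap.funLeft K K (Fin.castAdd 4) (pencil α β j)) =
      Matrix.scalar (Fin 4) α := by
    ext j i
    rw [LinearMap.funLeft_apply, pencil_castAdd]
    simp [Matrix.diagonal_apply, eq_comm]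
  rw [AlternatingMap.compLinearMap_apply]
  refine (congrArg Matrix.det this).trans ?_
  simp [Matrix.scalar_apply]

theorem finrank_span_of_linearIndependent_sum {u v : Fin 4 → Fin 8 → K}
    (h : LinearIndependent K (Sum.elim u v)) :
    finrank K (Submodule.span K (Set.range u)) = 4 ∧
      finrank K (Submodule.span K (Set.range v)) = 4 ∧
      Submodule.span K (Set.range u) ⊓ Submodule.span K (Set.range v) = ⊥ := by
  rw [linearIndependent_sum] at h
  refine ⟨?_, ?_, h.2.2.eq_bot⟩
  · exact (finrank_span_eq_card h.1).trans (Fintype.card_fin 4)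
  · exact (finrank_span_eq_card h.2.1).trans (Fintype.card_fin 4)

theorem finrank_span_partialDeriv_one {t : Fin 1 × Fin 4 × Fin 8 → K}
    {v : Fin 4 → Fin 8 → K} (h : LinearIndependent K (Sum.elim (fun j c => t (0, j, c)) v)) :
    finrank K (Submodule.span K (Set.range ((sumWedge K (Fin 8) 1 4).partialDeriv t))) = 17 := by
  rw [span_range_partialDeriv_sumWedge, iSup_unique]
  exact finrank_grassmannTangent (by simp) (finrank_span_of_linearIndependent_sum h).1

variable [CharZero K]

theorem finrank_span_partialDeriv_three {t : Fin 3 × Fin 4 × Fin 8 → K}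
    (h : ∀ i k, i ≠ k →
      LinearIndependent K (Sum.elim (fun j c => t (i, j, c)) fun j c => t (k, j, c))) :
    finrank K (Submodule.span K (Set.range ((sumWedge K (Fin 8) 3 4).partialDeriv t))) = 50 := by
  rw [span_range_partialDeriv_sumWedge]
  refine finrank_iSup_grassmannTangent (by simp) (fun i => ?_) fun i k hik =>
    (finrank_span_of_linearIndependent_sum (h i k hik)).2.2
  obtain ⟨k, hk⟩ := exists_ne i
  exact (finrank_span_of_linearIndependent_sum (h i k hk.symm)).1

theorem zariskiDim_pluckerGrassmannian_four_eight :
    zariskiDim K (pluckerGrassmannian K 4 (Fin 8 → K)) = 16 := by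
  rw [pluckerGrassmannian_eq_projImage]
  let _ := zariskiTopology K (⋀[K]^4 (Fin 8 → K))
  let t : Fin 1 × Fin 4 × Fin 8 → K := fun k => pencil 1 0 k.2.1 k.2.2
  have ht : LinearIndependent K (Sum.elim (fun j c => t (0, j, c)) (pencil 0 1)) :=
    linearIndependent_pencil (by simp)
  refine le_antisymm ?_ ?_
  · -- the rank is maximal where the first family is complementary to `e₅, …, e₈`
    let D : MvPolynomial (Fin 1 × Fin 4 × Fin 8) K :=
      (stackMatrix (fun j c => MvPolynomial.X (0, j, c))
        fun j c => MvPolynomial.C (pencil 0 1 j c)).det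
    have hD : ∀ s, MvPolynomial.eval s D =
        (stackMatrix (fun j c => s (0, j, c)) (pencil 0 1)).det := fun s => by
      rw [map_det_stackMatrix]
      simp only [MvPolynomial.eval_X, MvPolynomial.eval_C]
    refine zariskiDim_le_of_subset_closure_projImage (r := 16) (D := D) _ four_ne_zero
      subset_closure (fun h => ?_) fun s hs => ?_
    · have := hD t
      rw [h, map_zero] at this
      exact det_stackMatrix_ne_zero_iff.2 ht this.symm
    · rw [hD, det_stackMatrix_ne_zero_iff] at hs
      exact (finrank_span_partialDeriv_one hs).le
  · refine le_zariskiDim_of_projImage_subset (r := 16) (t := t) (sumWedge K (Fin 8) 1 4)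
      four_ne_zero subset_rfl (fun h => ?_) (finrank_span_partialDeriv_one ht).ge
    obtain ⟨ℓ, hℓ⟩ := exists_dual_ιMulti_pencil (K := K)
    rw [sumWedge_toFun, Fin.sum_univ_one] at h
    have := hℓ 1 0
    rw [show exteriorPower.ιMulti K 4 (pencil (1 : K) 0) = 0 from h, map_zero] at this
    simp at this

theorem zariskiDim_secantVariety_pluckerGrassmannian_four_eight :
    zariskiDim K (secantVariety K (pluckerGrassmannian K 4 (Fin 8 → K)) 3) = 49 := by
  rw [secantVariety, secant_pluckerGrassmannian_eq_projImage 3 four_pos]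
  let _ := zariskiTopology K (⋀[K]^4 (Fin 8 → K))
  let α : Fin 3 → K := fun i => if i = 1 then 0 else 1
  let β : Fin 3 → K := fun i => if i = 0 then 0 else 1
  let t : Fin 3 × Fin 4 × Fin 8 → K := fun k => pencil (α k.1) (β k.1) k.2.1 k.2.2
  have ht : ∀ i k, i ≠ k →
      LinearIndependent K (Sum.elim (fun j c => t (i, j, c)) fun j c => t (k, j, c)) := by
    intro i k hik
    have h : α i * β k - β i * α k ≠ 0 := by
      fin_cases i <;> fin_cases k <;> first | exact absurd rfl hik | simp [α, β]
    exact linearIndependent_pencil (α := α i) (β := β i) (γ := α k) (δ := β k) h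
  refine le_antisymm ?_ ?_
  · -- the rank is maximal where the three subspaces are pairwise complementary
    let D : MvPolynomial (Fin 3 × Fin 4 × Fin 8) K :=
      ∏ q ∈ Finset.univ.offDiag, (stackMatrix (fun j c => MvPolynomial.X (q.1, j, c))
        fun j c => MvPolynomial.X (q.2, j, c)).det
    have hD : ∀ s, MvPolynomial.eval s D ≠ 0 ↔ ∀ i k, i ≠ k →
        LinearIndependent K (Sum.elim (fun j c => s (i, j, c)) fun j c => s (k, j, c)) :=
      fun s => by
        simp only [D, map_prod, map_det_stackMatrix, MvPolynomial.eval_X, Finset.prod_ne_zero_iff,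
          det_stackMatrix_ne_zero_iff, Finset.mem_offDiag, Finset.mem_univ, true_and,
          Prod.forall]
    refine zariskiDim_le_of_subset_closure_projImage (r := 49) (D := D)
      (sumWedge K (Fin 8) 3 4) four_ne_zero subset_rfl (fun h => ?_)
      fun s hs => (finrank_span_partialDeriv_three ((hD s).1 hs)).le
    exact (hD t).2 ht (by rw [h, map_zero])
  · refine le_zariskiDim_of_projImage_subset (r := 49) (t := t) (sumWedge K (Fin 8) 3 4)
      four_ne_zero subset_closure (fun h => ?_) (finrank_span_partialDeriv_three ht).ge
    obtain ⟨ℓ, hℓ⟩ := exists_dual_ιMulti_pencil (K := K)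
    have h1 : ∑ i, exteriorPower.ιMulti K 4 (pencil (α i) (β i)) = 0 := h
    have h2 := congrArg ℓ h1
    rw [map_sum, map_zero] at h2
    simp only [hℓ, Fin.sum_univ_three] at h2
    rw [show α 0 = 1 from rfl, show α 1 = 0 from rfl, show α 2 = 1 from rfl] at h2
    norm_num at h2

end Generic

theorem mainTheorem4 (K : Type*) [Field K] [IsAlgClosed K] [CharZero K] :
    finrank K (⋀[K]^4 (Fin 8 → K)) = 69 + 1 ∧
    zariskiDim K (pluckerGrassmannian K 4 (Fin 8 → K)) = 16 ∧
    expectedSecantDim 69 16 3 = 50 ∧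
    zariskiDim K (secantVariety K (pluckerGrassmannian K 4 (Fin 8 → K)) 3) = 49 ∧
    HasSecantDefect K (pluckerGrassmannian K 4 (Fin 8 → K)) 3 1 ∧
    ∀ H : Fin 3 → Submodule K (Fin 8 → K), (∀ i, finrank K (H i) = 4) →
      (∀ i j, i ≠ j → H i ⊓ H j = ⊥) →
      finrank K (fatIntersection K H 4) = 20 := by
  have hN : finrank K (⋀[K]^4 (Fin 8 → K)) = 69 + 1 := by
    rw [exteriorPower.finrank_eq, finrank_fin_fun]
    rfl
  have hX := zariskiDim_pluckerGrassmannian_four_eight (K := K)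
  have hE : expectedSecantDim 69 16 3 = 50 := by norm_num [expectedSecantDim]
  have hS := zariskiDim_secantVariety_pluckerGrassmannian_four_eight (K := K)
  refine ⟨hN, hX, hE, hS, ⟨69, 16, 49, hN, hX, hS, ?_⟩, fun H hH hdisj =>
    finrank_fatIntersection_four (by simp) hH hdisj⟩
  rw [hE]
  norm_num
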